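/- Let $\mathcal H=\bigotimes_{a=1}^n\mathbb C^{d_a}$ be a finite-dimensional multipartite Hilbert space and let $\mathfrak D(\mathcal H)$ be the set of density operators (positive semidefinite, trace one). Fix a neighborhood structure $\mathcal N=\{\mathcal N_1,\dots,\mathcal N_K\}$, $K\ge 1$, of proper subsets $\mathcal N_j\subsetneq\{1,\dots,n\}$. For $S\subseteq\{1,\dots,n\}$ let $\overline S$ be its complement, and write $\mathcal H_S=\bigotimes_{a\in S}\mathbb C^{d_a}$. A \emph{neighborhood map} is a map $\mathcal E$ on $\mathcal B(\mathcal H)$ such that for some $j$ one has $\mathcal E=\mathcal E_{\mathcal N_j}\otimes\mathrm{Id}_{\overline{\mathcal N}_j}$ with $\mathcal E_{\mathcal N_j}$ completely positive and trace preserving; equivalently $\mathcal E(X)=\sum_k M_kXM_k^\dagger$ with a finite family $M_k=M_{\mathcal N_j,k}\otimes I_{\overline{\mathcal N}_j}$ satisfying $\sum_k M_k^\dagger M_k=I$. A state $\rho$ is \emph{discrete-time quasi-locally stabilizable} (QLS) if there is a sequence $\{\mathcal E_t\}_{t\ge 0}$ of neighborhood maps (the neighborhood may depend on $t$) such that the propagators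 $\mathcal E_{t,s}=\mathcal E_{t-1}\circ\cdots\circ\mathcal E_s$ ($\mathcal E_{s,s}=\mathrm{Id}$) satisfy $\mathcal E_{t,s}(\rho)=\rho$ for all $t\ge s\ge 0$ and $\lim_{t\to\infty}\mathcal E_{t,s}(\sigma)=\rho$ for all $\sigma\in\mathfrak D(\mathcal H)$ and all $s\ge 0$. A \emph{neighborhood generator} for $\mathcal N_j$ is a Lindblad generator $$\mathcal L_j(X)=-i[H,X]+\sum_k\Big(G_kXG_k^\dagger-\tfrac12\big(G_k^\dagger G_kX+XG_k^\dagger G_k\big)\Big),$$ with a finite family $\{G_k\}$, whose Hamiltonian $H=H^\dagger$ and noise operators $G_k$ all have the form $A\otimes I_{\overline{\mathcal N}_j}$ with $A\in\mathcal B(\mathcal H_{\mathcal N_j})$. A generator $\mathcal L=\sum_{j=1}^K\mathcal L_j$, with $\mathcal L_j$ a neighborhood generator for $\mathcal N_j$, is \emph{frustration free} if for every $\sigma\in\mathfrak D(\mathcal H)$: $\mathcal L(\sigma)=0$ if and only if $\mathcal L_j(\sigma)=0$ for all $j$. \textbf{Proposition.} Let $\rho\in\mathfrak D(\mathcal H)$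 be a pure state, $\rho=|\psi\rangle\langle\psi|$, or a state of full rank. Then $\rho$ is discrete-time QLS with respect to $\mathcal N$ if and only if there is a frustration-free generator $\mathcal L=\sum_{j=1}^K\mathcal L_j$ with respect to the same neighborhood structure $\mathcal N$ such that $\lim_{t\to+\infty}e^{\mathcal Lt}\rho_0=\rho$ for all $\rho_0\in\mathfrak D(\mathcal H)$. -/

import Mathlib

open scoped Matrix Kronecker ComplexOrder Topology

/-- Operators on the multipartite Hilbert space `⊗ₐ ℂ^{d a}`, written as matrices in the product
basis, which is labelled by the configurations `x : ∀ a, Fin (d a)`. -/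
abbrev MultiOp {n : ℕ} (d : Fin n → ℕ) : Type :=
  Matrix (∀ a, Fin (d a)) (∀ a, Fin (d a)) ℂ

/-- Operators on the tensor product `⊗_{a ∈ S} ℂ^{d a}` of the subsystems in `S`. -/
abbrev SubsystemOp {n : ℕ} (d : Fin n → ℕ) (S : Finset (Fin n)) : Type :=
  Matrix (∀ a : {a // a ∈ S}, Fin (d a)) (∀ a : {a // a ∈ S}, Fin (d a)) ℂ

/-- The operator `A ⊗ I` on the whole system, where `A` acts on the subsystems in `S` and the
identity acts on all the other subsystems. -/
def localOp {n : ℕ} {d : Fin n → ℕ} (S : Finset (Fin n)) (A : SubsystemOp d S) : MultiOp d :=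
  (A ⊗ₖ (1 : Matrix (∀ a : {a // a ∉ S}, Fin (d a)) (∀ a : {a // a ∉ S}, Fin (d a)) ℂ)).submatrix
    (Equiv.piEquivPiSubtypeProd (fun a => a ∈ S) (fun a => Fin (d a)))
    (Equiv.piEquivPiSubtypeProd (fun a => a ∈ S) (fun a => Fin (d a)))

/-- Density matrices: positive semidefinite of trace one. -/
def IsDensity {n : ℕ} {d : Fin n → ℕ} (ρ : MultiOp d) : Prop :=
  ρ.PosSemidef ∧ ρ.trace = 1

/-- Rank-one form `|ψ⟩⟨ψ|`; together with `IsDensity` it makes `ρ` a pure state. -/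
def IsPure {n : ℕ} {d : Fin n → ℕ} (ρ : MultiOp d) : Prop :=
  ∃ ψ : (∀ a, Fin (d a)) → ℂ, ρ = Matrix.vecMulVec ψ (star ψ)

/-- Full rank, that is, the matrix has rank `dim H`. -/
def IsFullRank {n : ℕ} {d : Fin n → ℕ} (ρ : MultiOp d) : Prop :=
  ρ.rank = Fintype.card (∀ a, Fin (d a))

/-- `E = E_S ⊗ Id` for a completely positive trace-preserving map `E_S` on the operators of the
subsystems in `S`, in operator-sum form. -/
def IsNeighborhoodChannel {n : ℕ} {d : Fin n → ℕ} (S : Finset (Fin n))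
    (E : MultiOp d →ₗ[ℂ] MultiOp d) : Prop :=
  ∃ (r : ℕ) (M : Fin r → SubsystemOp d S),
    ∑ k, (M k)ᴴ * M k = 1 ∧
      ∀ X, E X = ∑ k, localOp S (M k) * X * (localOp S (M k))ᴴ

/-- The propagator `E_{s+k,s} = E_{s+k-1} ∘ ⋯ ∘ E_s` over `k` steps starting at time `s`. -/
def propagator {n : ℕ} {d : Fin n → ℕ} (E : ℕ → (MultiOp d →ₗ[ℂ] MultiOp d)) (s : ℕ) :
    ℕ → (MultiOp d →ₗ[ℂ] MultiOp d)
  | 0 => LinearMap.id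
  | k + 1 => E (s + k) ∘ₗ propagator E s k

/-- Discrete-time quasi-local stabilizability of `ρ` for the neighborhoods `N j`. -/
def IsDiscreteQLS {n : ℕ} {d : Fin n → ℕ} {K : ℕ} (N : Fin K → Finset (Fin n))
    (ρ : MultiOp d) : Prop :=
  ∃ E : ℕ → (MultiOp d →ₗ[ℂ] MultiOp d),
    (∀ t, ∃ j, IsNeighborhoodChannel (N j) (E t)) ∧
    (∀ s k, propagator E s k ρ = ρ) ∧
    (∀ σ, IsDensity σ → ∀ s,
      Filter.Tendsto (fun k => propagator E s k σ) Filter.atTop (𝓝 ρ))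

/-- `L = L_S ⊗ Id` for a Lindblad generator `L_S` on the subsystems in `S`, that is,
`L X = -i [H, X] + ∑ₖ (Gₖ X Gₖ† - ½ (Gₖ† Gₖ X + X Gₖ† Gₖ))` with `H` and all `Gₖ` of the form
`A ⊗ I`. -/
def IsNeighborhoodGenerator {n : ℕ} {d : Fin n → ℕ} (S : Finset (Fin n))
    (L : MultiOp d →ₗ[ℂ] MultiOp d) : Prop :=
  ∃ (H : SubsystemOp d S) (r : ℕ) (G : Fin r → SubsystemOp d S),
    H.IsHermitian ∧
      ∀ X, L X = -Complex.I • (localOp S H * X - X * localOp S H) +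
        ∑ k, (localOp S (G k) * X * (localOp S (G k))ᴴ -
          (1 / 2 : ℂ) • ((localOp S (G k))ᴴ * localOp S (G k) * X +
            X * ((localOp S (G k))ᴴ * localOp S (G k))))

/-- The generator `∑ j, L j` is frustration free: the states that it annihilates are exactly those
that every neighborhood component `L j` annihilates. -/
def IsFrustrationFree {n : ℕ} {d : Fin n → ℕ} {K : ℕ}
    (L : Fin K → (MultiOp d →ₗ[ℂ] MultiOp d)) : Prop :=
  ∀ σ, IsDensity σ → ((∑ j, L j) σ = 0 ↔ ∀ j, L j σ = 0)

/-- The semigroup `t ↦ e^{t L}` of a linear map `L` on operators, through the exponential of the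
matrix of `t L` in the standard basis of matrix units. -/
noncomputable def semigroup {n : ℕ} {d : Fin n → ℕ} (L : MultiOp d →ₗ[ℂ] MultiOp d) (t : ℝ) :
    MultiOp d →ₗ[ℂ] MultiOp d :=
  Matrix.toLin (Matrix.stdBasis ℂ (∀ a, Fin (d a)) (∀ a, Fin (d a)))
    (Matrix.stdBasis ℂ (∀ a, Fin (d a)) (∀ a, Fin (d a)))
    (NormedSpace.exp ((t : ℂ) •
      LinearMap.toMatrix (Matrix.stdBasis ℂ (∀ a, Fin (d a)) (∀ a, Fin (d a)))
        (Matrix.stdBasis ℂ (∀ a, Fin (d a)) (∀ a, Fin (d a))) L))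

/-- Quasi-local stabilizability of `ρ` by frustration-free continuous-time dynamics for the
neighborhoods `N j`. -/
def IsFrustrationFreeQLS {n : ℕ} {d : Fin n → ℕ} {K : ℕ} (N : Fin K → Finset (Fin n))
    (ρ : MultiOp d) : Prop :=
  ∃ L : Fin K → (MultiOp d →ₗ[ℂ] MultiOp d),
    (∀ j, IsNeighborhoodGenerator (N j) (L j)) ∧
    IsFrustrationFree L ∧
    (∀ σ, IsDensity σ →
      Filter.Tendsto (fun t : ℝ => semigroup (∑ j, L j) t σ) Filter.atTop (𝓝 ρ))

/-! Both directions work in the base norm on traceless Hermitian matrices, whose unit ball is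
`densityDiff`. Positive trace-preserving maps never expand it, and in finite dimension convergence
of all densities to `ρ` is uniform on it. So stabilization yields one finite-time map that halves
the norm (`exists_pos_contractsBy_half`), and such a map can be carried from one kind of dynamics to
the other.

From discrete to continuous time: let `P = E_{m-1} ∘ ⋯ ∘ E_0` halve the norm and put `S = ∑ E_t`.
The generator `S - m = ∑ (E_t - 1)` is a sum of neighborhood generators that annihilate `ρ`.
Expanding `S ^ m` gives `exp S ≥ S ^ m / m! ≥ P / m!` in the order of positive maps, so `exp (S -
m)` is a convex mixture of `P` and another positive trace-preserving map. It is therefore a strict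
contraction (`exists_contractsBy_exp`), and `ρ` is the only stationary density, which gives
frustration freeness.

From continuous to discrete time: frustration freeness gives `L_j ρ = 0` for each `j`, so the
backward Euler steps `(1 - s L_j)⁻¹` fix `ρ`. For small `s > 0` they are neighborhood channels, by a
Neumann series with completely positive terms. By Chernoff's formula
(`tendsto_pow_exp_of_hasDerivAt`), cyclic products of these steps approximate `exp (t ∑ L_j)`
closely enough to inherit its contraction, and repeating the cycle forever stabilizes `ρ`. -/

open Filter

/-! ### Density matrices and the base norm. -/

section Density

variable {ι : Type*} [Fintype ι]

/-- The set of density matrices. -/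
def densitySet (ι : Type*) [Fintype ι] : Set (Matrix ι ι ℂ) :=
  {σ | σ.PosSemidef ∧ σ.trace = 1}

/-- Differences of density matrices: the unit ball of the base norm on traceless Hermitian
matrices. -/
def densityDiff (ι : Type*) [Fintype ι] : Set (Matrix ι ι ℂ) :=
  {X | ∃ σ ∈ densitySet ι, ∃ τ ∈ densitySet ι, X = σ - τ}

theorem isClosed_posSemidef : IsClosed {X : Matrix ι ι ℂ | X.PosSemidef} := by
  simp only [Matrix.posSemidef_iff_dotProduct_mulVec, Matrix.IsHermitian, Set.ofPred_and,
    Set.ofPred_forall]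
  refine (isClosed_eq (by fun_prop) (by fun_prop)).inter (isClosed_iInter fun v => ?_)
  exact isClosed_Ici.preimage
    (f := fun X : Matrix ι ι ℂ => star v ⬝ᵥ X *ᵥ v) (by fun_prop)

theorem posSemidef_of_hasSum {β : Type*} {f : β → Matrix ι ι ℂ} {X : Matrix ι ι ℂ}
    (hf : ∀ b, (f b).PosSemidef) (h : HasSum f X) : X.PosSemidef :=
  isClosed_posSemidef.mem_of_tendsto h
    (Eventually.of_forall fun s => Matrix.posSemidef_sum s fun i _ => hf i)

theorem smul_add_smul_mem_densitySet {σ τ : Matrix ι ι ℂ} (hσ : σ ∈ densitySet ι)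
    (hτ : τ ∈ densitySet ι) {a b : ℝ} (ha : 0 ≤ a) (hb : 0 ≤ b) (hab : a + b = 1) :
    (a : ℂ) • σ + (b : ℂ) • τ ∈ densitySet ι := by
  refine ⟨(hσ.1.smul (by exact_mod_cast ha)).add (hτ.1.smul (by exact_mod_cast hb)), ?_⟩
  rw [Matrix.trace_add, Matrix.trace_smul, Matrix.trace_smul, hσ.2, hτ.2]
  simpa using (by exact_mod_cast hab : (a : ℂ) + b = 1)

theorem inv_trace_smul_mem_densitySet {X : Matrix ι ι ℂ} (hX : X.PosSemidef)
    (h0 : X.trace ≠ 0) : X.trace⁻¹ • X ∈ densitySet ι := by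
  refine ⟨hX.smul ?_, by simp [Matrix.trace_smul, h0]⟩
  exact inv_nonneg.2 hX.trace_nonneg

-- Factor `σ = B† B`: the trace condition bounds every column of `B` by 1 in `ℓ²`, and an entry of
-- `σ` is an inner product of two columns.
open scoped MatrixOrder Matrix.Norms.L2Operator in
theorem norm_entry_le_one_of_mem_densitySet {σ : Matrix ι ι ℂ} (hσ : σ ∈ densitySet ι)
    (i j : ι) : ‖σ i j‖ ≤ 1 := by
  classical
  obtain ⟨B, hB⟩ := CStarAlgebra.nonneg_iff_eq_star_mul_self.1 hσ.1.nonneg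
  rw [Matrix.star_eq_conjTranspose] at hB
  have hdiag : ∀ i, ∑ k, ‖B k i‖ ^ 2 ≤ 1 := by
    have htr : ∑ i, ∑ k, ‖B k i‖ ^ 2 = 1 := by
      have h := hσ.2
      rw [hB] at h
      simp only [Matrix.trace, Matrix.diag_apply, Matrix.mul_apply, Matrix.conjTranspose_apply,
        RCLike.star_def, Complex.conj_mul'] at h
      exact_mod_cast h
    intro i
    rw [← htr]
    exact Finset.single_le_sum (f := fun i => ∑ k, ‖B k i‖ ^ 2)
      (fun i _ => Finset.sum_nonneg fun k _ => by positivity) (Finset.mem_univ i)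
  calc ‖σ i j‖ = ‖∑ k, star (B k i) * B k j‖ := by
        rw [hB]; simp [Matrix.mul_apply, Matrix.conjTranspose_apply]
    _ ≤ ∑ k, ‖B k i‖ * ‖B k j‖ := by
        refine (norm_sum_le _ _).trans (Finset.sum_le_sum fun k _ => ?_)
        rw [norm_mul, norm_star]
    _ ≤ ∑ k, (‖B k i‖ ^ 2 + ‖B k j‖ ^ 2) / 2 := by
        refine Finset.sum_le_sum fun k _ => ?_
        nlinarith [sq_nonneg (‖B k i‖ - ‖B k j‖)]
    _ = (∑ k, ‖B k i‖ ^ 2 + ∑ k, ‖B k j‖ ^ 2) / 2 := by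
        rw [← Finset.sum_add_distrib, Finset.sum_div]
    _ ≤ 1 := by linarith [hdiag i, hdiag j]

theorem norm_entry_le_two_of_mem_densityDiff {X : Matrix ι ι ℂ} (hX : X ∈ densityDiff ι)
    (i j : ι) : ‖X i j‖ ≤ 2 := by
  obtain ⟨σ, hσ, τ, hτ, rfl⟩ := hX
  refine (norm_sub_le _ _).trans ?_
  linarith [norm_entry_le_one_of_mem_densitySet hσ i j,
    norm_entry_le_one_of_mem_densitySet hτ i j]

/-- Reduces bounds that are uniform over `densityDiff`, where entries are at most 2, to the finitely
many matrix units. -/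
theorem eq_sum_smul_map_single [DecidableEq ι] {V : Type*} [AddCommMonoid V] [Module ℂ V]
    (g : Matrix ι ι ℂ →ₗ[ℂ] V) (X : Matrix ι ι ℂ) :
    g X = ∑ i, ∑ j, X i j • g (Matrix.single i j 1) := by
  conv_lhs => rw [Matrix.matrix_eq_sum_single X]
  simp only [map_sum]
  refine Finset.sum_congr rfl fun i _ => Finset.sum_congr rfl fun j _ => ?_
  rw [← map_smul, Matrix.smul_single, smul_eq_mul, mul_one]

open scoped Matrix.Norms.L2Operator in
theorem exists_norm_le_of_mem_densityDiff [DecidableEq ι] :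
    ∃ C : ℝ, 0 ≤ C ∧ ∀ X ∈ densityDiff ι, ‖X‖ ≤ C := by
  refine ⟨∑ i, ∑ j, 2 * ‖Matrix.single i j (1 : ℂ)‖,
    Finset.sum_nonneg fun (i : ι) _ => Finset.sum_nonneg fun (j : ι) _ =>
      mul_nonneg zero_le_two (norm_nonneg _), fun X hX => ?_⟩
  have h := eq_sum_smul_map_single (LinearMap.id (R := ℂ)) X
  rw [LinearMap.id_apply] at h
  conv_lhs => rw [h]
  refine (norm_sum_le _ _).trans (Finset.sum_le_sum fun i _ => ?_)
  refine (norm_sum_le _ _).trans (Finset.sum_le_sum fun j _ => ?_)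
  rw [norm_smul]
  exact mul_le_mul_of_nonneg_right (norm_entry_le_two_of_mem_densityDiff hX i j) (norm_nonneg _)

theorem isHermitian_of_mem_densityDiff {X : Matrix ι ι ℂ} (hX : X ∈ densityDiff ι) :
    X.IsHermitian ∧ X.trace = 0 := by
  obtain ⟨σ, hσ, τ, hτ, rfl⟩ := hX
  exact ⟨hσ.1.1.sub hτ.1.1, by rw [Matrix.trace_sub, hσ.2, hτ.2, sub_self]⟩

end Density

open scoped Matrix.Norms.L2Operator MatrixOrder in
theorem posSemidef_add_norm_smul_one {ι : Type*} [Fintype ι] [DecidableEq ι]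
    {X : Matrix ι ι ℂ} (hX : X.IsHermitian) : (X + (‖X‖ : ℂ) • 1).PosSemidef := by
  have h := IsSelfAdjoint.neg_algebraMap_norm_le_self (a := X) hX
  rw [Matrix.le_iff, sub_neg_eq_add] at h
  have h2 : (algebraMap ℝ (Matrix ι ι ℂ)) ‖X‖ = (‖X‖ : ℂ) • 1 := by
    rw [Algebra.algebraMap_eq_smul_one]
    ext i j; simp
  rwa [h2] at h

open scoped Matrix.Norms.L2Operator in
theorem exists_posSemidef_add_smul_one {ι : Type*} [Fintype ι] [DecidableEq ι]
    {X : Matrix ι ι ℂ} (hX : X.IsHermitian) : ∃ c : ℝ, (X + (c : ℂ) • 1).PosSemidef :=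
  ⟨_, posSemidef_add_norm_smul_one hX⟩

open scoped Matrix.Norms.L2Operator in
theorem eventually_posSemidef_add_smul_one {ι : Type*} [Fintype ι] [DecidableEq ι]
    {ε : ℝ} (hε : 0 < ε) :
    ∀ᶠ X in 𝓝 (0 : Matrix ι ι ℂ), X.IsHermitian → (X + (ε : ℂ) • 1).PosSemidef := by
  filter_upwards [Metric.ball_mem_nhds (0 : Matrix ι ι ℂ) hε] with X hX hH
  have h1 := posSemidef_add_norm_smul_one hH
  have h2 : ((ε - ‖X‖ : ℝ) : ℂ) • (1 : Matrix ι ι ℂ) = (ε : ℂ) • 1 - (‖X‖ : ℂ) • 1 := by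
    rw [← sub_smul]; push_cast; rfl
  have h3 : (((ε - ‖X‖ : ℝ) : ℂ) • (1 : Matrix ι ι ℂ)).PosSemidef := by
    refine Matrix.PosSemidef.one.smul ?_
    have : ‖X‖ < ε := by simpa [dist_eq_norm] using hX
    exact_mod_cast (sub_nonneg.2 this.le)
  rw [h2] at h3
  convert h1.add h3 using 1
  abel

section Density

variable {ι : Type*} [Fintype ι]

/-- Small traceless Hermitian matrices are absorbed by the differences of density matrices. -/
theorem eventually_mem_half_densityDiff [Nonempty ι] :
    ∀ᶠ X in 𝓝 (0 : Matrix ι ι ℂ), X.IsHermitian → X.trace = 0 →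
      ∃ Y ∈ densityDiff ι, X = ((1 / 2 : ℝ) : ℂ) • Y := by
  classical
  set N : ℝ := (Fintype.card ι : ℝ) with hN
  have hNpos : 0 < N := by simp [hN, Fintype.card_pos]
  have hNC : (N : ℂ) ≠ 0 := by exact_mod_cast hNpos.ne'
  have hε : 0 < 1 / (2 * N) := by positivity
  filter_upwards [eventually_posSemidef_add_smul_one (ι := ι) hε] with X hX hH htr
  have htr1 : (1 : Matrix ι ι ℂ).trace = N := by simp [hN]
  -- With `ε = 1 / (2N)`, the matrices `2(X + ε)` and `1 / N` both have trace one, and since `2ε = 1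
  -- / N` they differ by exactly `2X`.
  refine ⟨(2 : ℂ) • X, ⟨(2 : ℂ) • (X + ((1 / (2 * N) : ℝ) : ℂ) • 1), ⟨(hX hH).smul (by simp), ?_⟩,
    (N : ℂ)⁻¹ • 1, ⟨Matrix.PosSemidef.one.smul ?_, ?_⟩, ?_⟩, ?_⟩
  · rw [Matrix.trace_smul, Matrix.trace_add, Matrix.trace_smul, htr, htr1]
    push_cast
    simp only [smul_eq_mul]
    field_simp
    simp
  · exact inv_nonneg.2 (by exact_mod_cast hNpos.le)
  · rw [Matrix.trace_smul, htr1, smul_eq_mul, inv_mul_cancel₀ hNC]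
  · rw [smul_add, smul_smul, add_sub_assoc, ← sub_smul]
    have : (2 : ℂ) * ((1 / (2 * N) : ℝ) : ℂ) - (N : ℂ)⁻¹ = 0 := by
      push_cast; field_simp; simp
    rw [this, zero_smul, add_zero]
  · rw [smul_smul]; push_cast; norm_num

open scoped ComplexStarModule in
/-- Density matrices span all matrices. -/
theorem span_densitySet : Submodule.span ℂ (densitySet ι) = ⊤ := by
  classical
  have hpos : ∀ X : Matrix ι ι ℂ, X.PosSemidef → X ∈ Submodule.span ℂ (densitySet ι) := by
    intro X hX
    by_cases h0 : X.trace = 0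
    · rw [hX.trace_eq_zero_iff.1 h0]; exact Submodule.zero_mem _
    · have := Submodule.smul_mem _ X.trace
        (Submodule.subset_span (R := ℂ) (inv_trace_smul_mem_densitySet hX h0))
      rwa [smul_smul, mul_inv_cancel₀ h0, one_smul] at this
  have hherm : ∀ X : Matrix ι ι ℂ, X.IsHermitian → X ∈ Submodule.span ℂ (densitySet ι) := by
    intro X hX
    obtain ⟨c, hc⟩ := exists_posSemidef_add_smul_one hX
    have := Submodule.sub_mem _ (hpos _ hc)
      (Submodule.smul_mem _ (c : ℂ) (hpos 1 Matrix.PosSemidef.one))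
    rwa [add_sub_cancel_right] at this
  -- Every matrix is a complex combination of two Hermitian ones, each a difference of positive
  -- ones.
  refine Submodule.eq_top_iff'.2 fun X => ?_
  have h := Submodule.add_mem _ (hherm (ℜ X : Matrix ι ι ℂ) (realPart X).2)
    (Submodule.smul_mem _ Complex.I (hherm (ℑ X : Matrix ι ι ℂ) (imaginaryPart X).2))
  rwa [realPart_add_I_smul_imaginaryPart] at h

end Density

open scoped Matrix.Norms.L2Operator

/-! ### Contraction of the base norm by positive trace-preserving maps. -/

section PositiveMaps

variable {ι : Type*} [Fintype ι]

/-- Positive trace-preserving linear maps on matrices. -/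
structure IsPositiveTP (f : Matrix ι ι ℂ →L[ℂ] Matrix ι ι ℂ) : Prop where
  posSemidef : ∀ X, X.PosSemidef → (f X).PosSemidef
  trace : ∀ X, (f X).trace = X.trace

namespace IsPositiveTP

variable {f g : Matrix ι ι ℂ →L[ℂ] Matrix ι ι ℂ}

theorem one : IsPositiveTP (1 : Matrix ι ι ℂ →L[ℂ] Matrix ι ι ℂ) := ⟨fun _ h => h, fun _ => rfl⟩

theorem mul (hf : IsPositiveTP f) (hg : IsPositiveTP g) : IsPositiveTP (f * g) :=
  ⟨fun X hX => hf.1 _ (hg.1 X hX), fun X => (hf.2 _).trans (hg.2 X)⟩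

theorem mem_densitySet (hf : IsPositiveTP f) {σ : Matrix ι ι ℂ} (hσ : σ ∈ densitySet ι) :
    f σ ∈ densitySet ι := ⟨hf.1 _ hσ.1, (hf.2 _).trans hσ.2⟩

theorem mem_densityDiff (hf : IsPositiveTP f) {X : Matrix ι ι ℂ} (hX : X ∈ densityDiff ι) :
    f X ∈ densityDiff ι := by
  obtain ⟨σ, hσ, τ, hτ, rfl⟩ := hX
  exact ⟨f σ, hf.mem_densitySet hσ, f τ, hf.mem_densitySet hτ, map_sub f σ τ⟩

end IsPositiveTP

/-- `f` shrinks the base norm on traceless Hermitian matrices by the factor `r`. -/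
def ContractsBy (f : Matrix ι ι ℂ →L[ℂ] Matrix ι ι ℂ) (r : ℝ) : Prop :=
  ∀ X ∈ densityDiff ι, ∃ Y ∈ densityDiff ι, f X = (r : ℂ) • Y

namespace ContractsBy

variable {f g : Matrix ι ι ℂ →L[ℂ] Matrix ι ι ℂ} {r s : ℝ}

theorem mul (hf : ContractsBy f r) (hg : ContractsBy g s) : ContractsBy (f * g) (r * s) := by
  intro X hX
  obtain ⟨Y, hY, h1⟩ := hg X hX
  obtain ⟨Z, hZ, h2⟩ := hf Y hY
  refine ⟨Z, hZ, ?_⟩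
  rw [mul_apply_eq_comp, h1, map_smul, h2, smul_smul]
  push_cast
  rw [mul_comm]

end ContractsBy

theorem IsPositiveTP.contractsBy_one {f : Matrix ι ι ℂ →L[ℂ] Matrix ι ι ℂ}
    (hf : IsPositiveTP f) : ContractsBy f 1 := fun X hX =>
  ⟨f X, hf.mem_densityDiff hX, by simp⟩

theorem ContractsBy.pow {f : Matrix ι ι ℂ →L[ℂ] Matrix ι ι ℂ} {r : ℝ} (hf : ContractsBy f r)
    (n : ℕ) : ContractsBy (f ^ n) (r ^ n) := by
  induction n with
  | zero => simpa using IsPositiveTP.one.contractsBy_one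
  | succ n ih => rw [pow_succ, pow_succ]; exact ih.mul hf

variable [DecidableEq ι]

theorem ContractsBy.norm_apply_le {f : Matrix ι ι ℂ →L[ℂ] Matrix ι ι ℂ} {r C : ℝ} (hC : ∀ X ∈ densityDiff ι, ‖X‖ ≤ C) (hf : ContractsBy f r)
    (hr : 0 ≤ r) {X : Matrix ι ι ℂ} (hX : X ∈ densityDiff ι) : ‖f X‖ ≤ r * C := by
  obtain ⟨Y, hY, h⟩ := hf X hX
  rw [h, norm_smul, Complex.norm_real, Real.norm_of_nonneg hr]
  exact mul_le_mul_of_nonneg_left (hC Y hY) hr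

/-- A family of maps that sends every density matrix to a common limit does so uniformly. -/
theorem tendsto_norm_densityDiff {α : Type*} {l : Filter α}
    {f : α → Matrix ι ι ℂ →L[ℂ] Matrix ι ι ℂ} {ρ : Matrix ι ι ℂ}
    (hf : ∀ σ ∈ densitySet ι, Tendsto (fun a => f a σ) l (𝓝 ρ)) {ε : ℝ} (hε : 0 < ε) :
    ∀ᶠ a in l, ∀ X ∈ densityDiff ι, ‖f a X‖ < ε := by
  -- As densities span, the pointwise limit on all matrices is `X ↦ tr X • ρ`, which vanishes on
  -- `densityDiff`.
  have hall : ∀ X, Tendsto (fun a => f a X) l (𝓝 (X.trace • ρ)) := by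
    intro X
    have hX : X ∈ Submodule.span ℂ (densitySet ι) := by rw [span_densitySet]; trivial
    induction hX using Submodule.span_induction with
    | mem σ hσ => simpa [hσ.2] using hf σ hσ
    | zero => simpa using tendsto_const_nhds
    | add X Y _ _ hX hY =>
      simpa only [map_add, Matrix.trace_add, add_smul] using hX.add hY
    | smul c X _ hX =>
      simpa only [map_smul, Matrix.trace_smul, smul_assoc] using hX.const_smul c
  have hsum : Tendsto (fun a => ∑ i, ∑ j, 2 * ‖f a (Matrix.single i j 1) -
      (Matrix.single i j (1 : ℂ)).trace • ρ‖) l (𝓝 0) := by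
    have : (0 : ℝ) = ∑ i : ι, ∑ j : ι, 2 * 0 := by simp
    rw [this]
    refine tendsto_finsetSum _ fun i _ => tendsto_finsetSum _ fun j _ => ?_
    exact (tendsto_iff_norm_sub_tendsto_zero.1 (hall (Matrix.single i j 1))).const_mul 2
  filter_upwards [hsum.eventually_lt_const hε] with a ha X hX
  refine lt_of_le_of_lt ?_ ha
  have htr := (isHermitian_of_mem_densityDiff hX).2
  have h := eq_sum_smul_map_single ((f a : Matrix ι ι ℂ →ₗ[ℂ] Matrix ι ι ℂ) -
    (Matrix.traceLinearMap ι ℂ ℂ).smulRight ρ) X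
  simp only [LinearMap.sub_apply, LinearMap.smulRight_apply, Matrix.traceLinearMap_apply, htr,
    zero_smul, sub_zero, ContinuousLinearMap.coe_coe] at h
  rw [h]
  refine (norm_sum_le _ _).trans (Finset.sum_le_sum fun i _ => ?_)
  refine (norm_sum_le _ _).trans (Finset.sum_le_sum fun j _ => ?_)
  rw [norm_smul]
  exact mul_le_mul_of_nonneg_right
    (norm_entry_le_two_of_mem_densityDiff hX i j) (norm_nonneg _)

/-- Positive trace-preserving maps that are small on differences of density matrices halve the
base norm. -/
theorem exists_pos_contractsBy_half [Nonempty ι] :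
    ∃ ε > 0, ∀ f : Matrix ι ι ℂ →L[ℂ] Matrix ι ι ℂ, IsPositiveTP f →
      (∀ X ∈ densityDiff ι, ‖f X‖ < ε) → ContractsBy f (1 / 2) := by
  obtain ⟨ε, hε, h⟩ := Metric.eventually_nhds_iff.1 (eventually_mem_half_densityDiff (ι := ι))
  refine ⟨ε, hε, fun f hf hs X hX => ?_⟩
  obtain ⟨hH, ht⟩ := isHermitian_of_mem_densityDiff (hf.mem_densityDiff hX)
  exact h (by simpa [dist_eq_norm] using hs X hX) hH ht

end PositiveMaps

/-! ### Exponentials in Banach algebras and their action on vectors. -/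

section BanachAlgebra

variable {A : Type*} [NormedRing A] [NormedAlgebra ℂ A]

theorem exp_real_smul_one (c : ℝ) :
    NormedSpace.exp ((c : ℂ) • (1 : A)) = (Real.exp c : ℂ) • 1 := by
  rw [← Algebra.algebraMap_eq_smul_one, ← Algebra.algebraMap_eq_smul_one,
    ← NormedSpace.algebraMap_exp_comm, Complex.ofReal_exp, Complex.exp_eq_exp_ℂ]

variable [CompleteSpace A]

theorem exp_add_of_commute_complex {x y : A} (h : Commute x y) :
    NormedSpace.exp (x + y) = NormedSpace.exp x * NormedSpace.exp y :=
  let _ := NormedAlgebra.restrictScalars ℚ ℂ A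
  NormedSpace.exp_add_of_commute h

theorem exp_nsmul_complex (n : ℕ) (x : A) :
    NormedSpace.exp ((n : ℂ) • x) = NormedSpace.exp x ^ n := by
  let _ := NormedAlgebra.restrictScalars ℚ ℂ A
  rw [← NormedSpace.exp_nsmul, Nat.cast_smul_eq_nsmul]

/-- Exhibits the semigroup of `S - m` as a positive scalar times the exponential of a positive map.
-/
theorem exp_smul_sub_smul_one (S : A) (m t : ℝ) :
    NormedSpace.exp ((t : ℂ) • (S - (m : ℂ) • 1)) =
      (Real.exp (-(t * m)) : ℂ) • NormedSpace.exp ((t : ℂ) • S) := by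
  have : (t : ℂ) • (S - (m : ℂ) • 1) = ((-(t * m) : ℝ) : ℂ) • 1 + (t : ℂ) • S := by
    push_cast; module
  have hcomm : Commute (((-(t * m) : ℝ) : ℂ) • (1 : A)) ((t : ℂ) • S) :=
    (Commute.one_left _).smul_left _
  rw [this, exp_add_of_commute_complex hcomm, exp_real_smul_one, smul_one_mul]

/-- Reduces decay in real time to powers of the time-one map. -/
theorem exp_smul_eq_pow_floor_mul (L : A) (t : ℝ) :
    NormedSpace.exp ((t : ℂ) • L) =
      NormedSpace.exp L ^ ⌊t⌋₊ * NormedSpace.exp (((t - ⌊t⌋₊ : ℝ) : ℂ) • L) := by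
  have hcomm : Commute ((⌊t⌋₊ : ℂ) • L) (((t - ⌊t⌋₊ : ℝ) : ℂ) • L) :=
    ((Commute.refl L).smul_left _).smul_right _
  rw [← exp_nsmul_complex, ← exp_add_of_commute_complex hcomm, ← add_smul]
  congr 2; push_cast; ring

end BanachAlgebra

section ExpApply

variable {V : Type*} [NormedAddCommGroup V] [NormedSpace ℂ V] [CompleteSpace V]

theorem hasSum_exp_apply (A : V →L[ℂ] V) (X : V) :
    HasSum (fun n : ℕ => ((n.factorial : ℂ)⁻¹) • (A ^ n) X) (NormedSpace.exp A X) :=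
  (NormedSpace.exp_series_hasSum_exp' (𝕂 := ℂ) A).mapL (ContinuousLinearMap.apply ℂ V X)

theorem exp_apply_eq_self {A : V →L[ℂ] V} {X : V} (h : A X = 0) : NormedSpace.exp A X = X := by
  refine (hasSum_exp_apply A X).unique ?_
  convert hasSum_single (f := fun n : ℕ => ((n.factorial : ℂ)⁻¹) • (A ^ n) X) 0 ?_
  · simp
  · intro n hn
    obtain ⟨k, rfl⟩ := Nat.exists_eq_succ_of_ne_zero hn
    simp [pow_succ, h]

/-- A linear functional killed by the generator is conserved; applied to the trace. -/
theorem apply_exp_of_comp_eq_zero {W : Type*} [NormedAddCommGroup W] [NormedSpace ℂ W]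
    {A : V →L[ℂ] V} (φ : V →L[ℂ] W) (h : ∀ X, φ (A X) = 0) (X : V) :
    φ (NormedSpace.exp A X) = φ X := by
  refine ((hasSum_exp_apply A X).mapL φ).unique ?_
  convert hasSum_single (f := fun n : ℕ => φ (((n.factorial : ℂ)⁻¹) • (A ^ n) X)) 0 ?_
  · simp
  · intro n hn
    obtain ⟨k, rfl⟩ := Nat.exists_eq_succ_of_ne_zero hn
    simp [pow_succ', h]

end ExpApply

/-! ### Contraction and convergence of semigroups generated by `S - m`. -/

section Semigroup

variable {ι : Type*} [Fintype ι] [DecidableEq ι]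

theorem exp_apply_posSemidef {S : Matrix ι ι ℂ →L[ℂ] Matrix ι ι ℂ}
    (hS : ∀ X, X.PosSemidef → (S X).PosSemidef) {X : Matrix ι ι ℂ} (hX : X.PosSemidef) :
    (NormedSpace.exp S X).PosSemidef := by
  refine posSemidef_of_hasSum (fun n => ?_) (hasSum_exp_apply S X)
  refine Matrix.PosSemidef.smul ?_ (by positivity)
  induction n with
  | zero => simpa
  | succ n ih => rw [pow_succ', mul_apply_eq_comp]; exact hS _ ih

/-- If `S` dominates `P` to order `m` then `exp S` dominates `P / m!`. -/
theorem exp_apply_sub_posSemidef {S P : Matrix ι ι ℂ →L[ℂ] Matrix ι ι ℂ} {m : ℕ}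
    (hS : ∀ X, X.PosSemidef → (S X).PosSemidef)
    (hP : ∀ X, X.PosSemidef → ((S ^ m) X - P X).PosSemidef)
    {X : Matrix ι ι ℂ} (hX : X.PosSemidef) :
    (NormedSpace.exp S X - ((m.factorial : ℂ)⁻¹) • P X).PosSemidef := by
  -- The correction is charged to the term `n = m` alone; all other terms of the series are already
  -- positive.
  refine posSemidef_of_hasSum (fun n => ?_)
    ((hasSum_exp_apply S X).sub (hasSum_pi_single m (((m.factorial : ℂ)⁻¹) • P X)))
  rcases eq_or_ne n m with rfl | hn
  · rw [Pi.single_eq_same, ← smul_sub]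
    exact (hP X hX).smul (by positivity)
  · rw [Pi.single_eq_of_ne hn, sub_zero]
    refine Matrix.PosSemidef.smul ?_ (by positivity)
    clear hn
    induction n with
    | zero => simpa
    | succ n ih => rw [pow_succ', mul_apply_eq_comp]; exact hS _ ih

theorem isPositiveTP_exp {S : Matrix ι ι ℂ →L[ℂ] Matrix ι ι ℂ} {m t : ℝ} (ht : 0 ≤ t)
    (hS : ∀ X, X.PosSemidef → (S X).PosSemidef)
    (htr : ∀ X, (S X - (m : ℂ) • X).trace = 0) :
    IsPositiveTP (NormedSpace.exp ((t : ℂ) • (S - (m : ℂ) • 1))) := by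
  refine ⟨fun X hX => ?_, fun X => ?_⟩
  · have h : NormedSpace.exp ((t : ℂ) • (S - (m : ℂ) • 1)) =
        (Real.exp (-(t * m)) : ℂ) • NormedSpace.exp ((t : ℂ) • S) := exp_smul_sub_smul_one S m t
    rw [h]
    have hpos : (0 : ℂ) ≤ (Real.exp (-(t * m)) : ℂ) := by exact_mod_cast (Real.exp_pos _).le
    exact (exp_apply_posSemidef (fun Y hY => (hS Y hY).smul
      (show (0 : ℂ) ≤ (t : ℂ) by exact_mod_cast ht)) hX).smul hpos
  · refine apply_exp_of_comp_eq_zero (LinearMap.toContinuousLinearMap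
      (Matrix.traceLinearMap ι ℂ ℂ)) (fun Y => ?_) X
    simpa using Or.inr (htr Y)

/-- A Doeblin argument: `Φ = c P + (1 - c) R` with `R` positive and trace preserving, so the share
`c` of the mass is halved and the rest does not expand. -/
theorem exists_contractsBy_exp {S P : Matrix ι ι ℂ →L[ℂ] Matrix ι ι ℂ} {m : ℕ}
    (hS : ∀ X, X.PosSemidef → (S X).PosSemidef)
    (htr : ∀ X, (S X - (m : ℂ) • X).trace = 0)
    (hP : ∀ X, X.PosSemidef → ((S ^ m) X - P X).PosSemidef)
    (hPtp : IsPositiveTP P) (hc : ContractsBy P (1 / 2)) :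
    ∃ r : ℝ, 0 ≤ r ∧ r < 1 ∧ ContractsBy (NormedSpace.exp (S - (m : ℂ) • 1)) r := by
  set Φ := NormedSpace.exp (S - (m : ℂ) • 1) with hΦ
  have hΦ' : Φ = (Real.exp (-(m : ℝ)) : ℂ) • NormedSpace.exp S := by
    have := exp_smul_sub_smul_one S m 1
    simpa using this
  have hΦtp : IsPositiveTP Φ := by
    have := isPositiveTP_exp (m := m) zero_le_one hS (by simpa using htr)
    simpa using this
  -- Half of the available weight `exp (-m) / m!`: this keeps `1 - c` positive even when `m = 0`.
  set c : ℝ := Real.exp (-(m : ℝ)) * (m.factorial : ℝ)⁻¹ / 2 with hcdef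
  have hc0 : 0 < c := by positivity
  have hc1 : c ≤ 1 / 2 := by
    have h1 : Real.exp (-(m : ℝ)) ≤ 1 := by simp
    have h2 : (m.factorial : ℝ)⁻¹ ≤ 1 :=
      inv_le_one_of_one_le₀ (by exact_mod_cast m.factorial_pos)
    have := mul_le_mul h1 h2 (by positivity) zero_le_one
    linarith
  have hc2 : (0 : ℝ) < 1 - c := by linarith
  have hdom : ∀ X, X.PosSemidef → (Φ X - (c : ℂ) • P X).PosSemidef := by
    intro X hX
    have h1 := (exp_apply_sub_posSemidef hS hP hX).smul
      (a := ((Real.exp (-(m : ℝ)) : ℝ) : ℂ)) (by exact_mod_cast (Real.exp_pos _).le)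
    have h2 := (hPtp.1 X hX).smul (a := (c : ℂ)) (by exact_mod_cast hc0.le)
    have h3 : Φ X - (c : ℂ) • P X = ((Real.exp (-(m : ℝ)) : ℝ) : ℂ) •
        (NormedSpace.exp S X - ((m.factorial : ℂ)⁻¹) • P X) + (c : ℂ) • P X := by
      rw [hΦ', _root_.smul_apply, smul_sub, smul_smul, sub_add, ← sub_smul]
      congr 2
      rw [hcdef]; push_cast; ring
    rw [h3]
    exact h1.add h2
  have hR : ∀ σ ∈ densitySet ι, ((1 - c : ℝ) : ℂ)⁻¹ • (Φ σ - (c : ℂ) • P σ) ∈ densitySet ι := by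
    intro σ hσ
    have ht : (Φ σ - (c : ℂ) • P σ).trace = ((1 - c : ℝ) : ℂ) := by
      rw [Matrix.trace_sub, Matrix.trace_smul, hΦtp.2, hPtp.2, hσ.2]; simp
    have := inv_trace_smul_mem_densitySet (hdom σ hσ.1) (by rw [ht]; exact_mod_cast hc2.ne')
    rwa [ht] at this
  -- The rate is `c / 2 + (1 - c)`, from `P` and from `R` respectively; dividing by it gives the
  -- convex weights below.
  refine ⟨1 - c / 2, by linarith, by linarith, ?_⟩
  rintro X hX
  obtain ⟨Y, ⟨σ₁, hσ₁, τ₁, hτ₁, rfl⟩, hY⟩ := hc X hX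
  obtain ⟨σ, hσ, τ, hτ, rfl⟩ := hX
  have hcC : ((1 - c : ℝ) : ℂ) ≠ 0 := by exact_mod_cast hc2.ne'
  have hcC2 : ((1 - c / 2 : ℝ) : ℂ) ≠ 0 := by
    have : (1 - c / 2 : ℝ) ≠ 0 := by linarith
    exact_mod_cast this
  have ha : 0 ≤ (c / 2) / (1 - c / 2) := div_nonneg (by linarith) (by linarith)
  have hb : 0 ≤ (1 - c) / (1 - c / 2) := div_nonneg (by linarith) (by linarith)
  have hab : (c / 2) / (1 - c / 2) + (1 - c) / (1 - c / 2) = 1 := by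
    rw [← add_div, div_eq_one_iff_eq (by linarith)]; ring
  refine ⟨_, ⟨_, smul_add_smul_mem_densitySet hσ₁ (hR σ hσ) ha hb hab,
    _, smul_add_smul_mem_densitySet hτ₁ (hR τ hτ) ha hb hab, rfl⟩, ?_⟩
  have key : Φ (σ - τ) = (c : ℂ) • P (σ - τ) +
      ((Φ σ - (c : ℂ) • P σ) - (Φ τ - (c : ℂ) • P τ)) := by
    rw [map_sub, map_sub, smul_sub]; abel
  rw [key, hY]
  have hcC3 : (2 : ℂ) - c ≠ 0 := by
    have : (2 - c : ℝ) ≠ 0 := by linarith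
    exact_mod_cast this
  push_cast at hcC hcC2 ⊢
  generalize Φ σ - (c : ℂ) • P σ = U
  generalize Φ τ - (c : ℂ) • P τ = W
  match_scalars <;> field_simp

/-- A positive trace-preserving semigroup with a contracting time-one map and a fixed density
matrix converges. -/
theorem tendsto_exp_of_contractsBy {L : Matrix ι ι ℂ →L[ℂ] Matrix ι ι ℂ} {ρ σ : Matrix ι ι ℂ}
    {r : ℝ} (hr0 : 0 ≤ r) (hr1 : r < 1)
    (hL : ∀ t : ℝ, 0 ≤ t → IsPositiveTP (NormedSpace.exp ((t : ℂ) • L)))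
    (hc : ContractsBy (NormedSpace.exp L) r) (hρ : ρ ∈ densitySet ι) (hLρ : L ρ = 0)
    (hσ : σ ∈ densitySet ι) :
    Tendsto (fun t : ℝ => NormedSpace.exp ((t : ℂ) • L) σ) atTop (𝓝 ρ) := by
  obtain ⟨C, -, hC⟩ := exists_norm_le_of_mem_densityDiff (ι := ι)
  rw [tendsto_iff_norm_sub_tendsto_zero]
  have hlim : Tendsto (fun t : ℝ => r ^ ⌊t⌋₊ * C) atTop (𝓝 0) := by
    simpa using ((tendsto_pow_atTop_nhds_zero_of_lt_one hr0 hr1).comp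
      tendsto_nat_floor_atTop).mul_const C
  refine tendsto_of_tendsto_of_tendsto_of_le_of_le' tendsto_const_nhds hlim
    (Eventually.of_forall fun t => norm_nonneg _) ?_
  filter_upwards [eventually_ge_atTop 0] with t ht
  have hfr : 0 ≤ t - ⌊t⌋₊ := sub_nonneg.2 (Nat.floor_le ht)
  have h2 : NormedSpace.exp ((t : ℂ) • L) σ - ρ = NormedSpace.exp ((t : ℂ) • L) (σ - ρ) := by
    rw [map_sub, exp_apply_eq_self (X := ρ) (by simp [hLρ])]
  have h1 : NormedSpace.exp ((t : ℂ) • L) =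
      NormedSpace.exp L ^ ⌊t⌋₊ * NormedSpace.exp (((t - ⌊t⌋₊ : ℝ) : ℂ) • L) :=
    exp_smul_eq_pow_floor_mul L t
  rw [h2, h1, mul_apply_eq_comp]
  exact (hc.pow _).norm_apply_le hC (pow_nonneg hr0 _)
    ((hL _ hfr).mem_densityDiff ⟨σ, hσ, ρ, hρ, rfl⟩)

end Semigroup

/-! ### Local operators, neighborhood channels and generators, propagators. -/

section MultiOp

variable {n : ℕ} {d : Fin n → ℕ}

/-- Termwise comparison of the two exponential series lets everything else use the exponential in
the Banach algebra of continuous linear maps. -/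
theorem semigroup_apply (L : MultiOp d →ₗ[ℂ] MultiOp d) (t : ℝ) (X : MultiOp d) :
    semigroup L t X = NormedSpace.exp ((t : ℂ) • L.toContinuousLinearMap) X := by
  set b := Matrix.stdBasis ℂ (∀ a, Fin (d a)) (∀ a, Fin (d a)) with hb
  have h1 := NormedSpace.exp_series_hasSum_exp' (𝕂 := ℂ) ((t : ℂ) • LinearMap.toMatrix b b L)
  have h2 := h1.mapL (LinearMap.toContinuousLinearMap
    ((LinearMap.applyₗ X).comp (Matrix.toLin b b).toLinearMap))
  have h3 : ∀ k : ℕ, Matrix.toLin b b (((t : ℂ) • LinearMap.toMatrix b b L) ^ k) =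
      ((((t : ℂ) • L.toContinuousLinearMap) ^ k : MultiOp d →L[ℂ] MultiOp d) :
        MultiOp d →ₗ[ℂ] MultiOp d) := by
    intro k
    induction k with
    | zero => simp [Module.End.one_eq_id]
    | succ k ih =>
      rw [pow_succ, Matrix.toLin_mul b b b, ih, pow_succ, map_smul, Matrix.toLin_toMatrix]
      rfl
  have h4 := hasSum_exp_apply ((t : ℂ) • L.toContinuousLinearMap) X
  have h5 : (fun k : ℕ => Matrix.toLin b b
      (((k.factorial : ℂ)⁻¹) • ((t : ℂ) • LinearMap.toMatrix b b L) ^ k) X) =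
      fun k : ℕ => ((k.factorial : ℂ)⁻¹) • (((t : ℂ) • L.toContinuousLinearMap) ^ k) X := by
    funext k
    rw [map_smul, h3]
    rfl
  have h6 : HasSum (fun k : ℕ => Matrix.toLin b b
      (((k.factorial : ℂ)⁻¹) • ((t : ℂ) • LinearMap.toMatrix b b L) ^ k) X) (semigroup L t X) := h2
  rw [h5] at h6
  exact h6.unique h4

theorem localOp_mul (S : Finset (Fin n)) (A B : SubsystemOp d S) :
    localOp S (A * B) = localOp S A * localOp S B := by
  rw [localOp, localOp, localOp, Matrix.submatrix_mul_equiv, ← Matrix.mul_kronecker_mul, one_mul]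

theorem localOp_one (S : Finset (Fin n)) : localOp (d := d) S 1 = 1 := by
  rw [localOp, Matrix.one_kronecker_one, Matrix.submatrix_one_equiv]

theorem localOp_conjTranspose (S : Finset (Fin n)) (A : SubsystemOp d S) :
    localOp S Aᴴ = (localOp S A)ᴴ := by
  rw [localOp, localOp, Matrix.conjTranspose_submatrix, Matrix.conjTranspose_kronecker,
    Matrix.conjTranspose_one]

theorem localOp_add (S : Finset (Fin n)) (A B : SubsystemOp d S) :
    localOp S (A + B) = localOp S A + localOp S B := by
  simp only [localOp, Matrix.add_kronecker, Matrix.submatrix_add, Pi.add_apply]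

theorem localOp_smul (S : Finset (Fin n)) (c : ℂ) (A : SubsystemOp d S) :
    localOp S (c • A) = c • localOp S A := by
  simp only [localOp, Matrix.smul_kronecker, Matrix.submatrix_smul, Pi.smul_apply]

/-- `localOp` as a linear map. -/
noncomputable def localOpLinear (d : Fin n → ℕ) (S : Finset (Fin n)) :
    SubsystemOp d S →ₗ[ℂ] MultiOp d where
  toFun := localOp S
  map_add' := localOp_add S
  map_smul' := localOp_smul S

theorem localOp_sum {α : Type*} (S : Finset (Fin n)) (s : Finset α) (A : α → SubsystemOp d S) :
    localOp S (∑ k ∈ s, A k) = ∑ k ∈ s, localOp S (A k) :=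
  map_sum (localOpLinear d S) A s

theorem localOp_injective [Nonempty (∀ a, Fin (d a))] (S : Finset (Fin n)) :
    Function.Injective (localOp (d := d) S) := by
  intro A B h
  obtain ⟨z⟩ := ‹Nonempty (∀ a, Fin (d a))›
  set e := Equiv.piEquivPiSubtypeProd (fun a => a ∈ S) (fun a => Fin (d a)) with he
  ext x y
  -- Freezing the coordinates outside `S` at those of `z` recovers the entries of `A` and `B`; this
  -- is why a configuration must exist.
  have h1 := congrFun (congrFun h (e.symm (x, fun a => z a))) (e.symm (y, fun a => z a))
  simpa [localOp, ← he] using h1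

/-- Neighborhood channels are trace-preserving positive maps. -/
theorem IsNeighborhoodChannel.isPositiveTP {S : Finset (Fin n)} {E : MultiOp d →ₗ[ℂ] MultiOp d}
    (hE : IsNeighborhoodChannel S E) : IsPositiveTP E.toContinuousLinearMap := by
  obtain ⟨r, M, hM, hE⟩ := hE
  refine ⟨fun X hX => ?_, fun X => ?_⟩
  · rw [LinearMap.coe_toContinuousLinearMap', hE]
    exact Matrix.posSemidef_sum _ fun k _ => hX.mul_mul_conjTranspose_same _
  · rw [LinearMap.coe_toContinuousLinearMap', hE, Matrix.trace_sum]
    simp_rw [Matrix.trace_mul_comm _ (localOp S _)ᴴ, ← Matrix.mul_assoc]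
    rw [← Matrix.trace_sum, ← Finset.sum_mul]
    simp_rw [← localOp_conjTranspose, ← localOp_mul]
    rw [← localOp_sum, hM, localOp_one, one_mul]

/-- The generator `E - 1` of a neighborhood channel `E`. -/
theorem IsNeighborhoodChannel.isNeighborhoodGenerator_sub_id {S : Finset (Fin n)}
    {E : MultiOp d →ₗ[ℂ] MultiOp d} (hE : IsNeighborhoodChannel S E) :
    IsNeighborhoodGenerator S (E - LinearMap.id) := by
  obtain ⟨r, M, hM, hE⟩ := hE
  -- With zero Hamiltonian and the Kraus operators as noise, `∑ M† M = 1` turns the anticommutator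
  -- term into `-X`.
  refine ⟨0, r, M, Matrix.isHermitian_zero, fun X => ?_⟩
  have h1 : ∑ k, (localOp S (M k))ᴴ * localOp S (M k) = 1 := by
    simp_rw [← localOp_conjTranspose, ← localOp_mul]
    rw [← localOp_sum, hM, localOp_one]
  have h0 : localOp S (0 : SubsystemOp d S) = 0 := map_zero (localOpLinear d S)
  rw [LinearMap.sub_apply, hE, LinearMap.id_apply, Finset.sum_sub_distrib, ← Finset.smul_sum,
    Finset.sum_add_distrib, ← Finset.sum_mul, ← Finset.mul_sum, h1, h0]
  simp only [zero_mul, mul_zero, sub_zero, smul_zero, zero_add, one_mul, mul_one]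
  rw [← two_smul ℂ X, smul_smul]
  norm_num

theorem isNeighborhoodGenerator_zero (S : Finset (Fin n)) :
    IsNeighborhoodGenerator S (0 : MultiOp d →ₗ[ℂ] MultiOp d) := by
  refine ⟨0, 0, Fin.elim0, Matrix.isHermitian_zero, fun X => ?_⟩
  have h0 : localOp S (0 : SubsystemOp d S) = 0 := map_zero (localOpLinear d S)
  simp [h0]

theorem IsNeighborhoodGenerator.add {S : Finset (Fin n)} {L L' : MultiOp d →ₗ[ℂ] MultiOp d}
    (hL : IsNeighborhoodGenerator S L) (hL' : IsNeighborhoodGenerator S L') :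
    IsNeighborhoodGenerator S (L + L') := by
  obtain ⟨H, r, G, hH, hL⟩ := hL
  obtain ⟨H', r', G', hH', hL'⟩ := hL'
  refine ⟨H + H', r + r', Fin.append G G', hH.add hH', fun X => ?_⟩
  rw [LinearMap.add_apply, hL, hL', Fin.sum_univ_add, localOp_add]
  simp only [Fin.append_left, Fin.append_right, add_mul, mul_add, smul_sub, smul_add]
  abel

theorem isNeighborhoodGenerator_sum {α : Type*} {S : Finset (Fin n)} (s : Finset α)
    {L : α → MultiOp d →ₗ[ℂ] MultiOp d} (h : ∀ i ∈ s, IsNeighborhoodGenerator S (L i)) :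
    IsNeighborhoodGenerator S (∑ i ∈ s, L i) :=
  Finset.sum_induction L (IsNeighborhoodGenerator S) (fun _ _ => IsNeighborhoodGenerator.add)
    (isNeighborhoodGenerator_zero S) h

theorem propagator_isPositiveTP {E : ℕ → MultiOp d →ₗ[ℂ] MultiOp d}
    (hE : ∀ t, IsPositiveTP (E t).toContinuousLinearMap) (s k : ℕ) :
    IsPositiveTP (propagator E s k).toContinuousLinearMap := by
  induction k with
  | zero => exact IsPositiveTP.one
  | succ k ih => exact (hE (s + k)).mul ih

/-- The power of a sum of positive maps dominates the product of the first `k` summands. -/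
theorem pow_sum_sub_propagator_posSemidef {E : ℕ → MultiOp d →ₗ[ℂ] MultiOp d}
    (hE : ∀ t, IsPositiveTP (E t).toContinuousLinearMap) {m k : ℕ} (hk : k ≤ m)
    {X : MultiOp d} (hX : X.PosSemidef) :
    (((∑ t ∈ Finset.range m, E t) ^ k) X - propagator E 0 k X).PosSemidef := by
  induction k with
  | zero =>
    have : (((∑ t ∈ Finset.range m, E t) ^ 0) X - propagator E 0 0 X) = 0 := by
      simp [propagator]
    rw [this]; exact Matrix.PosSemidef.zero
  | succ k ih =>
    have hpos : ∀ s : Finset ℕ, ∀ Y : MultiOp d, Y.PosSemidef →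
        ((∑ t ∈ s, E t) Y).PosSemidef := fun s Y hY => by
      rw [LinearMap.sum_apply]
      exact Matrix.posSemidef_sum _ fun t _ => (hE t).1 Y hY
    have h1 := hpos (Finset.range m) _ (ih (by omega))
    have h2 := hpos ((Finset.range m).erase k) _ ((propagator_isPositiveTP hE 0 k).1 X hX)
    -- With `P_k` the propagator, `S ^ (k+1) - P_(k+1) = S (S ^ k - P_k) + (S - E_k) P_k`, a sum of
    -- two positive terms.
    have h3 : ((∑ t ∈ Finset.range m, E t) ^ (k + 1)) X - propagator E 0 (k + 1) X =
        (∑ t ∈ Finset.range m, E t) (((∑ t ∈ Finset.range m, E t) ^ k) X - propagator E 0 k X) +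
        (∑ t ∈ (Finset.range m).erase k, E t) (propagator E 0 k X) := by
      rw [← Finset.add_sum_erase _ E (Finset.mem_range.2 hk)]
      simp only [pow_succ', Module.End.mul_apply, map_sub, LinearMap.add_apply, propagator,
        LinearMap.comp_apply, zero_add]
      abel
    rw [h3]
    exact h1.add h2

end MultiOp

/-! ### From discrete-time stabilization to a frustration-free generator. -/

section MultiOp

variable {n : ℕ} {d : Fin n → ℕ}

theorem IsDensity.nonempty {ρ : MultiOp d} (hρ : IsDensity ρ) : Nonempty (∀ a, Fin (d a)) := by
  by_contra h
  rw [not_nonempty_iff] at h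
  have := hρ.2
  simp [Matrix.trace] at this

theorem isFrustrationFreeQLS_of_isDiscreteQLS {K : ℕ} {N : Fin K → Finset (Fin n)}
    {ρ : MultiOp d} (hρ : IsDensity ρ) (h : IsDiscreteQLS N ρ) : IsFrustrationFreeQLS N ρ := by
  have := hρ.nonempty
  obtain ⟨E, hE, hfix, hlim⟩ := h
  choose j hj using hE
  have htp : ∀ t, IsPositiveTP (E t).toContinuousLinearMap := fun t => (hj t).isPositiveTP
  have hEρ : ∀ t, E t ρ = ρ := fun t => by simpa [propagator] using hfix t 1
  obtain ⟨ε, hε, hhalf⟩ := exists_pos_contractsBy_half (ι := ∀ a, Fin (d a))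
  obtain ⟨m, hm⟩ := (tendsto_norm_densityDiff
    (f := fun k => (propagator E 0 k).toContinuousLinearMap) (l := atTop) (ρ := ρ)
    (fun σ hσ => hlim σ hσ 0) hε).exists
  have hc := hhalf _ (propagator_isPositiveTP htp 0 m) hm
  set S : MultiOp d →ₗ[ℂ] MultiOp d := ∑ t ∈ Finset.range m, E t with hS
  -- The first `m` steps are sorted by the neighborhood they act on; a neighborhood not used before
  -- time `m` gets the zero generator.
  set Lj : Fin K → MultiOp d →ₗ[ℂ] MultiOp d := fun i =>
    ∑ t ∈ Finset.range m with j t = i, (E t - LinearMap.id) with hLj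
  have hsum : ∑ i, Lj i = S - (m : ℂ) • LinearMap.id := by
    rw [hLj, Finset.sum_fiberwise, Finset.sum_sub_distrib, Finset.sum_const, Finset.card_range,
      Nat.cast_smul_eq_nsmul]
  have hLjρ : ∀ i, Lj i ρ = 0 := fun i => by
    simp only [hLj, LinearMap.sum_apply, LinearMap.sub_apply, hEρ, LinearMap.id_apply, sub_self,
      Finset.sum_const_zero]
  set L := (∑ i, Lj i).toContinuousLinearMap with hL
  have hLS : L = S.toContinuousLinearMap - (m : ℂ) • 1 := by
    rw [hL, hsum]; rfl
  have hSpos : ∀ X : MultiOp d, X.PosSemidef → (S.toContinuousLinearMap X).PosSemidef := by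
    intro X hX
    rw [LinearMap.coe_toContinuousLinearMap', hS, LinearMap.sum_apply]
    exact Matrix.posSemidef_sum _ fun t _ => (htp t).1 X hX
  have hStr : ∀ X : MultiOp d, (S.toContinuousLinearMap X - (m : ℂ) • X).trace = 0 := by
    intro X
    have h1 : ∀ t, (E t X).trace = X.trace := fun t => (htp t).2 X
    rw [LinearMap.coe_toContinuousLinearMap', hS, LinearMap.sum_apply, Matrix.trace_sub,
      Matrix.trace_sum, Matrix.trace_smul]
    simp [h1]
  obtain ⟨r, hr0, hr1, hr⟩ := exists_contractsBy_exp hSpos hStr (fun X hX => by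
    have h1 := pow_sum_sub_propagator_posSemidef htp le_rfl hX (m := m)
    have h2 : ∀ k : ℕ, (S.toContinuousLinearMap ^ k) X = (S ^ k) X := fun k => by
      induction k with
      | zero => rfl
      | succ k ih => rw [pow_succ', pow_succ', mul_apply_eq_comp, ih]; rfl
    rw [h2]; exact h1) (propagator_isPositiveTP htp 0 m) hc
  have hconv : ∀ σ, IsDensity σ →
      Tendsto (fun t : ℝ => semigroup (∑ i, Lj i) t σ) atTop (𝓝 ρ) := by
    intro σ hσ
    simp only [semigroup_apply]
    refine tendsto_exp_of_contractsBy hr0 hr1 (fun t ht => ?_) (by rwa [← hL, hLS]) hρ ?_ hσ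
    · rw [← hL, hLS]
      exact isPositiveTP_exp (m := (m : ℝ)) ht hSpos (by simpa using hStr)
    · rw [LinearMap.coe_toContinuousLinearMap', LinearMap.sum_apply]
      exact Finset.sum_eq_zero fun i _ => hLjρ i
  refine ⟨Lj, fun i => ?_, fun σ hσ => ⟨fun h0 => ?_, fun h0 => ?_⟩, hconv⟩
  · refine isNeighborhoodGenerator_sum _ fun t ht => ?_
    rw [← (Finset.mem_filter.1 ht).2]
    exact (hj t).isNeighborhoodGenerator_sub_id
  -- A stationary density is a constant trajectory, so it equals the common limit `ρ`.
  · have h1 : ∀ t : ℝ, semigroup (∑ i, Lj i) t σ = σ := fun t => by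
      rw [semigroup_apply]
      exact exp_apply_eq_self (by
        rw [_root_.smul_apply, LinearMap.coe_toContinuousLinearMap', h0, smul_zero])
    have h2 := hconv σ hσ
    simp only [h1] at h2
    rw [tendsto_nhds_unique tendsto_const_nhds h2]
    exact hLjρ
  · rw [LinearMap.sum_apply]
    exact Finset.sum_eq_zero fun i _ => h0 i

end MultiOp

/-! ### Neumann series, Chernoff's formula and resolvents. -/

section BanachAlgebra

variable {A : Type*} [NormedRing A]

/-- Telescoping; the factor `k` is later beaten by a one-step error `o(1/k)`. -/
theorem norm_pow_sub_pow_le_mul [NormOneClass A] {a b : A} {M : ℝ} (hM : 1 ≤ M) (ha : ‖a‖ ≤ M)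
    (hb : ‖b‖ ≤ M) (k : ℕ) : ‖a ^ k - b ^ k‖ ≤ k * M ^ k * ‖a - b‖ := by
  induction k with
  | zero => simp
  | succ k ih =>
    have h1 : a ^ (k + 1) - b ^ (k + 1) = a ^ k * (a - b) + (a ^ k - b ^ k) * b := by
      rw [pow_succ, pow_succ]; noncomm_ring
    have h2 : ‖a ^ k‖ ≤ M ^ (k + 1) :=
      ((norm_pow_le a k).trans (pow_le_pow_left₀ (norm_nonneg _) ha k)).trans
        (pow_le_pow_right₀ hM k.le_succ)
    rw [h1]
    calc ‖a ^ k * (a - b) + (a ^ k - b ^ k) * b‖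
        ≤ ‖a ^ k‖ * ‖a - b‖ + ‖a ^ k - b ^ k‖ * ‖b‖ :=
          (norm_add_le _ _).trans (add_le_add (norm_mul_le _ _) (norm_mul_le _ _))
      _ ≤ M ^ (k + 1) * ‖a - b‖ + (k * M ^ k * ‖a - b‖) * M :=
          add_le_add (mul_le_mul_of_nonneg_right h2 (norm_nonneg _))
            (mul_le_mul ih hb (norm_nonneg _) (by positivity))
      _ = (k + 1 : ℕ) * M ^ (k + 1) * ‖a - b‖ := by push_cast; ring

/-- Neumann series for the inverse of `B - C`. -/
theorem hasSum_inverse_sub [CompleteSpace A] {B B' C : A} (h1 : B * B' = 1) (h2 : B' * B = 1)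
    (h : ‖B' * C‖ < 1) :
    HasSum (fun k : ℕ => (B' * C) ^ k * B') (Ring.inverse (B - C)) := by
  have hs := summable_geometric_of_norm_lt_one h
  have hT : B - C = B * (1 - B' * C) := by
    rw [mul_sub, mul_one, ← mul_assoc, h1, one_mul]
  have hinv : Ring.inverse (B - C) = (∑' k : ℕ, (B' * C) ^ k) * B' := by
    refine Ring.inverse_unit ⟨B - C, (∑' k : ℕ, (B' * C) ^ k) * B', ?_, ?_⟩
    · rw [hT, mul_assoc, ← mul_assoc (1 - B' * C), mul_neg_geom_series _ h, one_mul, h1]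
    · rw [hT, mul_assoc, ← mul_assoc B', h2, one_mul, geom_series_mul_neg _ h]
  rw [hinv]
  exact hs.hasSum.mul_right B'

variable [NormedAlgebra ℂ A]

theorem hasDerivAt_one_zero : HasDerivAt (fun _ : ℝ => (1 : A)) 0 0 := hasDerivAt_const _ _

theorem hasDerivAt_mul_of_eq_one {f g : ℝ → A} {l m : A} (hf0 : f 0 = 1) (hg0 : g 0 = 1)
    (hf : HasDerivAt f l 0) (hg : HasDerivAt g m 0) :
    HasDerivAt (fun s => f s * g s) (m + l) 0 := by
  have h := hf.mul hg
  rwa [hf0, hg0, mul_one, one_mul, add_comm] at h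

theorem inverse_one_sub_zero_smul (l : A) : Ring.inverse (1 - ((0 : ℝ) : ℂ) • l) = 1 := by
  simp

variable [CompleteSpace A]

/-- Chernoff's product formula in a Banach algebra. -/
theorem tendsto_pow_exp_of_hasDerivAt [NormOneClass A] {a : ℝ → A} {l : A} (ha0 : a 0 = 1)
    (ha : HasDerivAt a l 0) {t : ℝ} (ht : 0 < t) :
    Tendsto (fun k : ℕ => a (t / k) ^ k) atTop (𝓝 (NormedSpace.exp ((t : ℂ) • l))) := by
  set b : ℝ → A := fun s => NormedSpace.exp ((s : ℂ) • l) with hbdef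
  have hb0 : b 0 = 1 := by simp [hbdef]
  have hb : HasDerivAt b l 0 := by
    simpa [hbdef] using hasDerivAt_exp_smul_const (𝕂 := ℝ) l 0
  -- This growth bound keeps the `k`-th powers of steps of size `t / k` bounded uniformly in `k`.
  have hlin : ∀ f : ℝ → A, f 0 = 1 → HasDerivAt f l 0 →
      ∀ᶠ s in 𝓝[>] (0 : ℝ), ‖f s‖ ≤ Real.exp ((‖l‖ + 1) * s) := by
    intro f hf0 hf
    have h := (hasDerivAt_iff_isLittleO.1 hf).def zero_lt_one
    filter_upwards [nhdsWithin_le_nhds h, self_mem_nhdsWithin] with s hs hpos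
    simp only [sub_zero, hf0, one_mul, Real.norm_of_nonneg (le_of_lt hpos)] at hs
    have h1 : f s = 1 + s • l + (f s - 1 - s • l) := by abel
    have h2 : ‖f s‖ ≤ 1 + s * ‖l‖ + s := by
      rw [h1]
      refine (norm_add_le _ _).trans (add_le_add ((norm_add_le _ _).trans (add_le_add ?_ ?_)) hs)
      · rw [norm_one]
      · rw [norm_smul, Real.norm_of_nonneg (le_of_lt hpos)]
    have h3 := Real.add_one_le_exp ((‖l‖ + 1) * s)
    linarith
  have hdiff : ∀ ε > 0, ∀ᶠ s in 𝓝[>] (0 : ℝ), ‖a s - b s‖ ≤ ε * s := by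
    intro ε hε
    have h := (hasDerivAt_iff_isLittleO.1 (ha.sub hb)).def hε
    filter_upwards [nhdsWithin_le_nhds h, self_mem_nhdsWithin] with s hs hpos
    simpa [ha0, hb0, abs_of_pos (show (0 : ℝ) < s from hpos)] using hs
  have hseq : Tendsto (fun k : ℕ => t / (k : ℝ)) atTop (𝓝[>] 0) := by
    refine tendsto_nhdsWithin_iff.2 ⟨tendsto_const_div_atTop_nhds_zero_nat t, ?_⟩
    filter_upwards [eventually_gt_atTop 0] with k hk
    exact div_pos ht (by exact_mod_cast hk)
  rw [tendsto_iff_norm_sub_tendsto_zero]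
  refine Metric.tendsto_atTop'.2 fun ε hε => ?_
  -- Chosen so that `k` one-step errors `ε / (2C) * (t / k)`, amplified by `exp ((‖l‖ + 1) t)`, add
  -- up to `ε / 2`.
  set C : ℝ := t * Real.exp ((‖l‖ + 1) * t) with hC
  have hCpos : 0 < C := by positivity
  have hev := (hseq.eventually (hlin a ha0 ha)).and ((hseq.eventually (hlin b hb0 hb)).and
    ((hseq.eventually (hdiff (ε / (2 * C)) (by positivity))).and (eventually_gt_atTop 0)))
  obtain ⟨k₀, hk₀⟩ := eventually_atTop.1 hev
  refine ⟨k₀, fun k hk => ?_⟩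
  obtain ⟨h1, h2, h3, hkpos⟩ := hk₀ k hk.le
  have hkR : (0 : ℝ) < k := by exact_mod_cast hkpos
  have hbk : NormedSpace.exp ((t : ℂ) • l) = b (t / k) ^ k := by
    simp only [hbdef]
    rw [← exp_nsmul_complex, smul_smul]
    congr 2
    push_cast
    field_simp
  have hM : 1 ≤ Real.exp ((‖l‖ + 1) * (t / k)) := Real.one_le_exp (by positivity)
  have h4 := norm_pow_sub_pow_le_mul hM h1 h2 k
  have h5 : (k : ℝ) * Real.exp ((‖l‖ + 1) * (t / k)) ^ k * ‖a (t / k) - b (t / k)‖ ≤ ε / 2 := by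
    rw [← Real.exp_nat_mul]
    have h6 : (k : ℝ) * ((‖l‖ + 1) * (t / k)) = (‖l‖ + 1) * t := by field_simp
    rw [h6]
    calc _ ≤ (k : ℝ) * Real.exp ((‖l‖ + 1) * t) * (ε / (2 * C) * (t / k)) :=
          mul_le_mul_of_nonneg_left h3 (by positivity)
      _ = ε / 2 := by rw [hC]; field_simp
  rw [dist_zero_right, norm_norm, hbk]
  linarith

/-- The backward Euler step is tangent to the semigroup at `s = 0`, as Chernoff's formula requires.
-/
theorem hasDerivAt_inverse_one_sub_smul (l : A) :
    HasDerivAt (fun s : ℝ => Ring.inverse (1 - (s : ℂ) • l)) l 0 := by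
  have h1 : HasDerivAt (fun s : ℝ => 1 - (s : ℂ) • l) (-l) 0 := by
    have h := ((Complex.ofRealCLM.hasDerivAt (x := (0 : ℝ))).smul_const l).const_sub (1 : A)
    simpa using h
  have h2 := hasFDerivAt_ringInverse (𝕜 := ℝ) (1 : Aˣ)
  have h3 : HasFDerivAt Ring.inverse (-((ContinuousLinearMap.mulLeftRight ℝ A)
      ((1 : Aˣ)⁻¹ : Aˣ)) ((1 : Aˣ)⁻¹ : Aˣ)) ((fun s : ℝ => 1 - (s : ℂ) • l) 0) := by
    simpa using h2
  simpa [Function.comp_def] using h3.comp_hasDerivAt (0 : ℝ) h1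

theorem eventually_isUnit_one_sub_smul (l : A) :
    ∀ᶠ s : ℝ in 𝓝 0, IsUnit (1 - (s : ℂ) • l) := by
  have h : ContinuousAt (fun s : ℝ => 1 - (s : ℂ) • l) 0 := by fun_prop
  exact h.eventually_mem (by simpa using Units.isOpen.mem_nhds (isUnit_one (M := A)))

/-- The product is continuous near `s = 0` and vanishes there. This is the convergence condition for
the Neumann series. -/
theorem eventually_norm_inverse_mul_lt_one (l D E : A) :
    ∀ᶠ s : ℝ in 𝓝 0, ‖Ring.inverse (1 - (s : ℂ) • l + ((s : ℂ) ^ 2 • D + (s : ℂ) • E)) *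
      ((s : ℂ) ^ 2 • D + (s : ℂ) • E)‖ < 1 := by
  have h1 : ContinuousAt (fun s : ℝ => (s : ℂ) ^ 2 • D + (s : ℂ) • E) 0 := by fun_prop
  have h2 : ContinuousAt (fun s : ℝ => 1 - (s : ℂ) • l + ((s : ℂ) ^ 2 • D + (s : ℂ) • E)) 0 := by
    fun_prop
  have h3 : ContinuousAt (fun s : ℝ => Ring.inverse
      (1 - (s : ℂ) • l + ((s : ℂ) ^ 2 • D + (s : ℂ) • E))) 0 := by
    refine ContinuousAt.comp (g := Ring.inverse) ?_ h2
    simpa using NormedRing.inverse_continuousAt (1 : Aˣ)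
  have h4 := (h3.mul h1).norm
  exact h4.eventually_lt continuousAt_const (by simp)

end BanachAlgebra

/-! ### Local completely positive maps through Choi matrices. -/

section LocalCP

variable {n : ℕ} {d : Fin n → ℕ} {S : Finset (Fin n)}

/-- The map `X ↦ A X B†` on operators. -/
noncomputable def sandwich (A B : MultiOp d) : MultiOp d →L[ℂ] MultiOp d :=
  (LinearMap.mulLeft ℂ A ∘ₗ LinearMap.mulRight ℂ Bᴴ).toContinuousLinearMap

@[simp]
theorem sandwich_apply (A B X : MultiOp d) : sandwich A B X = A * X * Bᴴ := by
  simp [sandwich, mul_assoc]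

/-- Completely positive maps with finitely many Kraus operators, all acting on `S` only. -/
def IsLocalCP (S : Finset (Fin n)) (f : MultiOp d →L[ℂ] MultiOp d) : Prop :=
  ∃ (r : ℕ) (M : Fin r → SubsystemOp d S),
    ∀ X, f X = ∑ k, localOp S (M k) * X * (localOp S (M k))ᴴ

theorem isLocalCP_of_fintype {κ : Type*} [Fintype κ] {f : MultiOp d →L[ℂ] MultiOp d}
    (M : κ → SubsystemOp d S)
    (h : ∀ X, f X = ∑ k, localOp S (M k) * X * (localOp S (M k))ᴴ) : IsLocalCP S f :=
  ⟨Fintype.card κ, M ∘ (Fintype.equivFin κ).symm, fun X => (h X).trans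
    (Equiv.sum_comp (Fintype.equivFin κ).symm
      (fun k => localOp S (M k) * X * (localOp S (M k))ᴴ)).symm⟩

namespace IsLocalCP

variable {f g : MultiOp d →L[ℂ] MultiOp d}

theorem sandwich_localOp (A : SubsystemOp d S) :
    IsLocalCP S (sandwich (localOp S A) (localOp S A)) :=
  isLocalCP_of_fintype (fun _ : Unit => A) fun X => by simp

theorem zero : IsLocalCP S (0 : MultiOp d →L[ℂ] MultiOp d) :=
  ⟨0, Fin.elim0, fun X => by simp⟩

theorem one : IsLocalCP S (1 : MultiOp d →L[ℂ] MultiOp d) :=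
  isLocalCP_of_fintype (fun _ : Unit => 1) fun X => by simp [localOp_one]

theorem add (hf : IsLocalCP S f) (hg : IsLocalCP S g) : IsLocalCP S (f + g) := by
  obtain ⟨r, M, hf⟩ := hf
  obtain ⟨r', M', hg⟩ := hg
  exact isLocalCP_of_fintype (Sum.elim M M') fun X => by simp [hf, hg]

theorem mul (hf : IsLocalCP S f) (hg : IsLocalCP S g) : IsLocalCP S (f * g) := by
  obtain ⟨r, M, hf⟩ := hf
  obtain ⟨r', M', hg⟩ := hg
  refine isLocalCP_of_fintype (fun p : Fin r × Fin r' => M p.1 * M' p.2) fun X => ?_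
  rw [mul_apply_eq_comp, hf, hg, Fintype.sum_prod_type]
  refine Finset.sum_congr rfl fun k _ => ?_
  simp only [localOp_mul, Matrix.conjTranspose_mul, Finset.mul_sum, Finset.sum_mul, mul_assoc]

theorem pow (hf : IsLocalCP S f) (k : ℕ) : IsLocalCP S (f ^ k) := by
  induction k with
  | zero => simpa using one
  | succ k ih => rw [pow_succ]; exact ih.mul hf

theorem smul (hf : IsLocalCP S f) {c : ℝ} (hc : 0 ≤ c) : IsLocalCP S ((c : ℂ) • f) := by
  obtain ⟨r, M, hf⟩ := hf
  refine ⟨r, fun k => (Real.sqrt c : ℂ) • M k, fun X => ?_⟩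
  have h : (Real.sqrt c : ℂ) * (Real.sqrt c : ℂ) = c := by
    exact_mod_cast Real.mul_self_sqrt hc
  rw [_root_.smul_apply, hf, Finset.smul_sum]
  refine Finset.sum_congr rfl fun k _ => ?_
  rw [localOp_smul, Matrix.conjTranspose_smul, Matrix.mul_smul, Matrix.smul_mul, Matrix.smul_mul,
    smul_smul, RCLike.star_def, Complex.conj_ofReal, h]

theorem sum {α : Type*} (s : Finset α) {f : α → MultiOp d →L[ℂ] MultiOp d}
    (h : ∀ i ∈ s, IsLocalCP S (f i)) : IsLocalCP S (∑ i ∈ s, f i) :=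
  Finset.sum_induction f (IsLocalCP S) (fun _ _ => add) zero h

end IsLocalCP

/-- The matrix units on the subsystems in `S`, acting on the whole system. -/
noncomputable def localUnit (S : Finset (Fin n))
    (p : (∀ a : {a // a ∈ S}, Fin (d a)) × (∀ a : {a // a ∈ S}, Fin (d a))) : MultiOp d :=
  localOp S (Matrix.single p.1 p.2 1)

/-- The map on operators with a given Choi matrix on the subsystems in `S`. -/
noncomputable def choiMap (d : Fin n → ℕ) (S : Finset (Fin n)) :
    Matrix ((∀ a : {a // a ∈ S}, Fin (d a)) × (∀ a : {a // a ∈ S}, Fin (d a)))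
      ((∀ a : {a // a ∈ S}, Fin (d a)) × (∀ a : {a // a ∈ S}, Fin (d a))) ℂ →ₗ[ℂ]
      (MultiOp d →L[ℂ] MultiOp d) where
  toFun C := ∑ p, ∑ q, C p q • sandwich (localUnit S p) (localUnit S q)
  map_add' C C' := by ext1 X; simp [add_smul, Finset.sum_add_distrib]
  map_smul' c C := by ext1 X; simp [Finset.smul_sum, smul_smul]

theorem choiMap_apply (C) (X : MultiOp d) : choiMap d S C X =
    ∑ p, ∑ q, C p q • (localUnit S p * X * (localUnit S q)ᴴ) := by
  simp [choiMap]

theorem localOp_eq_sum_localUnit (A : SubsystemOp d S) :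
    localOp S A = ∑ p : (∀ a : {a // a ∈ S}, Fin (d a)) × (∀ a : {a // a ∈ S}, Fin (d a)),
      A p.1 p.2 • localUnit S p := by
  rw [Fintype.sum_prod_type]
  exact eq_sum_smul_map_single (localOpLinear d S) A

/-- Rank-one Choi matrices correspond to single Kraus operators. -/
theorem choiMap_vecMulVec (A : SubsystemOp d S) :
    choiMap d S (Matrix.vecMulVec (fun p => A p.1 p.2) (star fun p => A p.1 p.2)) =
      sandwich (localOp S A) (localOp S A) := by
  ext1 X
  rw [choiMap_apply, sandwich_apply, localOp_eq_sum_localUnit A]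
  simp only [Matrix.conjTranspose_sum, Finset.sum_mul, Finset.mul_sum, Matrix.conjTranspose_smul,
    Matrix.smul_mul, Matrix.mul_smul, smul_smul, Matrix.vecMulVec_apply, Pi.star_apply]
  rw [Finset.sum_comm]
  refine Finset.sum_congr rfl fun p _ => Finset.sum_congr rfl fun q _ => ?_
  rw [mul_comm]

open scoped MatrixOrder in
theorem isLocalCP_iff_exists_choiMap {f : MultiOp d →L[ℂ] MultiOp d} :
    IsLocalCP S f ↔ ∃ C, C.PosSemidef ∧ choiMap d S C = f := by
  constructor
  · rintro ⟨r, M, hf⟩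
    refine ⟨∑ k, Matrix.vecMulVec (fun p => M k p.1 p.2) (star fun p => M k p.1 p.2),
      Matrix.posSemidef_sum _ fun k _ => Matrix.posSemidef_vecMulVec_self_star _, ?_⟩
    rw [map_sum]
    ext1 X
    simp [choiMap_vecMulVec, hf]
  · rintro ⟨C, hC, rfl⟩
    obtain ⟨B, hB⟩ := CStarAlgebra.nonneg_iff_eq_star_mul_self.1 hC.nonneg
    -- The conjugated rows of `B` in `C = B† B` are the Kraus operators.
    have h : C = ∑ k, Matrix.vecMulVec (fun p => star (B k (p.1, p.2)))
        (star fun p => star (B k (p.1, p.2))) := by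
      ext p q
      simp [hB, Matrix.star_eq_conjTranspose, Matrix.mul_apply, Matrix.sum_apply,
        Matrix.vecMulVec_apply]
    rw [h, map_sum]
    refine IsLocalCP.sum _ fun k _ => ?_
    exact (congrArg (IsLocalCP S) (choiMap_vecMulVec
      (Matrix.of fun x y => star (B k (x, y))))).mpr (IsLocalCP.sandwich_localOp _)

/-- With the outside coordinates frozen at `z'`, a suitable entry of the image of a matrix unit is
exactly `C p q`. -/
theorem choiMap_injective [Nonempty (∀ a, Fin (d a))] : Function.Injective (choiMap d S) := by
  rw [← LinearMap.ker_eq_bot, LinearMap.ker_eq_bot']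
  intro C hC
  obtain ⟨z⟩ := ‹Nonempty (∀ a, Fin (d a))›
  set e := Equiv.piEquivPiSubtypeProd (fun a => a ∈ S) (fun a => Fin (d a)) with he
  set z' : ∀ a : {a // a ∉ S}, Fin (d a) := fun a => z a
  have hentry : ∀ p x y, localUnit S p (e.symm (x, z')) (e.symm (y, z')) =
      if p = (x, y) then 1 else 0 := by
    intro p x y
    simp [localUnit, localOp, ← he, Matrix.single_apply, Prod.ext_iff]
  ext p q
  have h := congrFun (congrFun (congrArg (fun f : MultiOp d →L[ℂ] MultiOp d =>
    f (Matrix.single (e.symm (p.2, z')) (e.symm (q.2, z')) 1)) hC) (e.symm (p.1, z')))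
    (e.symm (q.1, z'))
  have hprod : ∀ (A B : MultiOp d) (u x y v : ∀ a, Fin (d a)),
      (A * Matrix.single x y (1 : ℂ) * Bᴴ : MultiOp d) u v = A u x * star (B v y) := by
    intro A B u x y v
    rw [Matrix.mul_apply, Finset.sum_eq_single y]
    · simp
    · intro w _ hw
      rw [Matrix.mul_single_apply_of_ne _ _ _ _ _ hw, zero_mul]
    · simp
  simpa [choiMap_apply, Matrix.sum_apply, hprod, hentry, apply_ite] using h

/-- Kraus families have no bounded length, so limits are taken on Choi matrices: an injective linear
map in finite dimension carries the closed positive cone to a closed set. -/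
theorem isClosed_setOf_isLocalCP [Nonempty (∀ a, Fin (d a))] :
    IsClosed {f : MultiOp d →L[ℂ] MultiOp d | IsLocalCP S f} := by
  have h : {f : MultiOp d →L[ℂ] MultiOp d | IsLocalCP S f} =
      choiMap d S '' {C | C.PosSemidef} := by
    ext f
    exact isLocalCP_iff_exists_choiMap
  rw [h]
  exact (LinearMap.isClosedEmbedding_of_injective
    (LinearMap.ker_eq_bot.2 choiMap_injective)).isClosedMap _ isClosed_posSemidef

theorem IsLocalCP.of_hasSum [Nonempty (∀ a, Fin (d a))] {α : Type*}
    {f : α → MultiOp d →L[ℂ] MultiOp d} {g : MultiOp d →L[ℂ] MultiOp d}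
    (hf : ∀ i, IsLocalCP S (f i)) (h : HasSum f g) : IsLocalCP S g :=
  isClosed_setOf_isLocalCP.mem_of_tendsto h
    (Eventually.of_forall fun s => IsLocalCP.sum s fun i _ => hf i)

/-- A trace-preserving local completely positive map is a neighborhood channel. -/
theorem IsLocalCP.isNeighborhoodChannel [Nonempty (∀ a, Fin (d a))]
    {f : MultiOp d →L[ℂ] MultiOp d} (hf : IsLocalCP S f) (htr : ∀ X, (f X).trace = X.trace) :
    IsNeighborhoodChannel S (f : MultiOp d →ₗ[ℂ] MultiOp d) := by
  obtain ⟨r, M, hf⟩ := hf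
  refine ⟨r, M, localOp_injective S ?_, hf⟩
  rw [localOp_one]
  -- Trace preservation determines `∑ M† M` on the whole system by nondegeneracy of the trace
  -- pairing; injectivity of `localOp` brings the identity down to `S`.
  refine Matrix.ext_iff_trace_mul_right.2 fun X => ?_
  rw [one_mul, ← htr X, hf, Matrix.trace_sum]
  simp_rw [Matrix.trace_mul_comm _ (localOp S _)ᴴ, ← Matrix.mul_assoc]
  rw [← Matrix.trace_sum, ← Finset.sum_mul, localOp_sum]
  simp_rw [localOp_mul, localOp_conjTranspose]

end LocalCP

/-! ### Backward Euler steps as channels, and convergence of propagators. -/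

section MultiOp

variable {n : ℕ} {d : Fin n → ℕ}

theorem IsNeighborhoodGenerator.trace_apply {S : Finset (Fin n)}
    {L : MultiOp d →ₗ[ℂ] MultiOp d} (hL : IsNeighborhoodGenerator S L) (X : MultiOp d) :
    (L X).trace = 0 := by
  obtain ⟨H, r, G, hH, hL⟩ := hL
  have h1 : ∀ A : MultiOp d, (A * X * Aᴴ).trace = (Aᴴ * A * X).trace := fun A => by
    rw [Matrix.trace_mul_comm, Matrix.mul_assoc]
  rw [hL, Matrix.trace_add, Matrix.trace_smul, Matrix.trace_sub,
    Matrix.trace_mul_comm (localOp S H), sub_self, smul_zero, zero_add, Matrix.trace_sum]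
  refine Finset.sum_eq_zero fun k _ => ?_
  rw [Matrix.trace_sub, Matrix.trace_smul, Matrix.trace_add, h1, Matrix.trace_mul_comm X]
  simp only [smul_eq_mul]
  ring

theorem localOp_sub (S : Finset (Fin n)) (A B : SubsystemOp d S) :
    localOp S (A - B) = localOp S A - localOp S B :=
  map_sub (localOpLinear d S) A B

/-- A neighborhood generator splits into a drift part and a completely positive part. -/
theorem IsNeighborhoodGenerator.exists_drift_add_isLocalCP {S : Finset (Fin n)}
    {L : MultiOp d →ₗ[ℂ] MultiOp d} (hL : IsNeighborhoodGenerator S L) :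
    ∃ (K : SubsystemOp d S) (E : MultiOp d →L[ℂ] MultiOp d), IsLocalCP S E ∧
      ∀ X, L X = localOp S K * X + X * (localOp S K)ᴴ + E X := by
  obtain ⟨H, r, G, hH, hL⟩ := hL
  -- The effective non-Hermitian drift `-iH - ½ ∑ G† G`.
  set K : SubsystemOp d S := -Complex.I • H - (1 / 2 : ℂ) • ∑ k, (G k)ᴴ * G k with hK
  refine ⟨K, ∑ k, sandwich (localOp S (G k)) (localOp S (G k)),
    IsLocalCP.sum _ fun k _ => IsLocalCP.sandwich_localOp _, fun X => ?_⟩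
  have hKloc : localOp S K = -Complex.I • localOp S H -
      (1 / 2 : ℂ) • ∑ k, (localOp S (G k))ᴴ * localOp S (G k) := by
    rw [hK, localOp_sub, localOp_smul, localOp_smul, localOp_sum]
    simp_rw [localOp_mul, localOp_conjTranspose]
  have hKadj : (localOp S K)ᴴ = Complex.I • localOp S H -
      (1 / 2 : ℂ) • ∑ k, (localOp S (G k))ᴴ * localOp S (G k) := by
    rw [hKloc, Matrix.conjTranspose_sub, Matrix.conjTranspose_smul, Matrix.conjTranspose_smul,
      Matrix.conjTranspose_sum, ← localOp_conjTranspose, hH.eq]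
    simp
  have hEX : (∑ k, sandwich (localOp S (G k)) (localOp S (G k))) X =
      ∑ k, localOp S (G k) * X * (localOp S (G k))ᴴ := by simp
  rw [hL, hKadj, hKloc, hEX, Finset.sum_sub_distrib, ← Finset.smul_sum, Finset.sum_add_distrib,
    ← Finset.sum_mul, ← Finset.mul_sum]
  simp only [sub_mul, mul_sub, Matrix.smul_mul, Matrix.mul_smul]
  module

/-- Completing the square: `1 - sL` is an explicitly invertible conjugation by `1 - sK` minus a
completely positive map. -/
theorem one_sub_smul_add_eq_sandwich {S : Finset (Fin n)} {L E : MultiOp d →L[ℂ] MultiOp d}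
    {K : SubsystemOp d S} (hL : ∀ X, L X = localOp S K * X + X * (localOp S K)ᴴ + E X) (s : ℝ) :
    1 - (s : ℂ) • L + ((s : ℂ) ^ 2 • sandwich (localOp S K) (localOp S K) + (s : ℂ) • E) =
      sandwich (localOp S (1 - (s : ℂ) • K)) (localOp S (1 - (s : ℂ) • K)) := by
  ext1 X
  have h2 : (1 - (s : ℂ) • L + ((s : ℂ) ^ 2 • sandwich (localOp S K) (localOp S K) +
      (s : ℂ) • E)) X = X - (s : ℂ) • L X +
        ((s : ℂ) ^ 2 • sandwich (localOp S K) (localOp S K) X + (s : ℂ) • E X) := rfl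
  rw [h2, sandwich_apply, sandwich_apply, localOp_sub, localOp_one, localOp_smul, hL,
    Matrix.conjTranspose_sub, Matrix.conjTranspose_smul, Matrix.conjTranspose_one,
    RCLike.star_def, Complex.conj_ofReal]
  simp only [sub_mul, mul_sub, Matrix.smul_mul, Matrix.mul_smul, one_mul, mul_one]
  module

theorem sandwich_localOp_mul_eq_one {S : Finset (Fin n)} {a b : SubsystemOp d S}
    (hab : a * b = 1) : sandwich (localOp S a) (localOp S a) *
      sandwich (localOp S b) (localOp S b) = 1 := by
  ext1 X
  rw [mul_apply_eq_comp, sandwich_apply, sandwich_apply]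
  have h1 : localOp S a * (localOp S b * X * (localOp S b)ᴴ) * (localOp S a)ᴴ =
      (localOp S a * localOp S b) * X * (localOp S a * localOp S b)ᴴ := by
    rw [Matrix.conjTranspose_mul]; simp only [mul_assoc]
  rw [h1, ← localOp_mul, hab, localOp_one]
  simp

/-- Every term of the Neumann series is local and completely positive, and such maps form a closed
cone. -/
theorem isLocalCP_inverse_sub [Nonempty (∀ a, Fin (d a))] {S : Finset (Fin n)}
    {B B' C : MultiOp d →L[ℂ] MultiOp d} (h1 : B * B' = 1) (h2 : B' * B = 1)
    (hB' : IsLocalCP S B') (hC : IsLocalCP S C) (h : ‖Ring.inverse B * C‖ < 1) :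
    IsLocalCP S (Ring.inverse (B - C)) := by
  have hinv : Ring.inverse B = B' := Ring.inverse_unit ⟨B, B', h1, h2⟩
  rw [hinv] at h
  have hsum := @hasSum_inverse_sub (MultiOp d →L[ℂ] MultiOp d) _ _ B B' C h1 h2 h
  exact IsLocalCP.of_hasSum (fun k => ((hB'.mul hC).pow k).mul hB') hsum

/-- The backward Euler step of a neighborhood generator is a neighborhood channel. -/
theorem IsNeighborhoodGenerator.eventually_isNeighborhoodChannel_inverse
    [Nonempty (∀ a, Fin (d a))] {S : Finset (Fin n)} {L : MultiOp d →ₗ[ℂ] MultiOp d}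
    (hL : IsNeighborhoodGenerator S L) :
    ∀ᶠ s : ℝ in 𝓝[>] 0, IsNeighborhoodChannel S
      ((Ring.inverse (1 - (s : ℂ) • L.toContinuousLinearMap) : MultiOp d →L[ℂ] MultiOp d) :
        MultiOp d →ₗ[ℂ] MultiOp d) := by
  have htr : ∀ X, (L.toContinuousLinearMap X).trace = 0 := hL.trace_apply
  obtain ⟨K, E, hE, hLK⟩ := hL.exists_drift_add_isLocalCP
  have hB := one_sub_smul_add_eq_sandwich (L := L.toContinuousLinearMap) hLK
  generalize L.toContinuousLinearMap = L' at *
  have hD : IsLocalCP S (sandwich (localOp S K) (localOp S K)) := IsLocalCP.sandwich_localOp K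
  generalize sandwich (localOp S K) (localOp S K) = D at *
  have hev1 : ∀ᶠ s : ℝ in 𝓝 0, IsUnit (1 - (s : ℂ) • K) := eventually_isUnit_one_sub_smul K
  have hev2 : ∀ᶠ s : ℝ in 𝓝 0, IsUnit (1 - (s : ℂ) • L') := eventually_isUnit_one_sub_smul L'
  have hev3 : ∀ᶠ s : ℝ in 𝓝 0, ‖Ring.inverse
      (1 - (s : ℂ) • L' + ((s : ℂ) ^ 2 • D + (s : ℂ) • E)) *
      ((s : ℂ) ^ 2 • D + (s : ℂ) • E)‖ < 1 := eventually_norm_inverse_mul_lt_one L' D E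
  filter_upwards [nhdsWithin_le_nhds hev1, nhdsWithin_le_nhds hev2, nhdsWithin_le_nhds hev3,
    self_mem_nhdsWithin] with s hu1 hu2 hnorm hs
  have hs0 : 0 ≤ s := le_of_lt hs
  have hC : IsLocalCP S ((s : ℂ) ^ 2 • D + (s : ℂ) • E) := by
    refine IsLocalCP.add ?_ (hE.smul hs0)
    rw [← Complex.ofReal_pow]
    exact hD.smul (pow_nonneg hs0 2)
  have hBs := hB s
  generalize (s : ℂ) ^ 2 • D + (s : ℂ) • E = C at *
  obtain ⟨u, hu⟩ := hu1
  rw [← hu] at hBs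
  rw [hBs] at hnorm
  have hcp := isLocalCP_inverse_sub (sandwich_localOp_mul_eq_one u.mul_inv)
    (sandwich_localOp_mul_eq_one u.inv_mul) (IsLocalCP.sandwich_localOp _) hC hnorm
  rw [← hBs, add_sub_cancel_right] at hcp
  refine hcp.isNeighborhoodChannel fun X => ?_
  have h1 : (1 - (s : ℂ) • L') (Ring.inverse (1 - (s : ℂ) • L') X) = X := by
    rw [← mul_apply_eq_comp, Ring.mul_inverse_cancel _ hu2]; rfl
  -- Since `L'` has traceless range, `1 - sL'` preserves the trace, hence so does its inverse.
  have h2 : ∀ Y, ((1 - (s : ℂ) • L') Y).trace = Y.trace := by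
    intro Y
    have : (1 - (s : ℂ) • L') Y = Y - (s : ℂ) • L' Y := rfl
    rw [this, Matrix.trace_sub, Matrix.trace_smul, htr, smul_zero, sub_zero]
  rw [← h2, h1]

theorem propagator_add (E : ℕ → MultiOp d →ₗ[ℂ] MultiOp d) (s k l : ℕ) :
    propagator E s (k + l) = propagator E (s + k) l ∘ₗ propagator E s k := by
  induction l with
  | zero => rfl
  | succ l ih => rw [← add_assoc, propagator, ih, propagator, LinearMap.comp_assoc, add_assoc]

theorem propagator_congr {E E' : ℕ → MultiOp d →ₗ[ℂ] MultiOp d} {s s' k : ℕ}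
    (h : ∀ i < k, E (s + i) = E' (s' + i)) : propagator E s k = propagator E' s' k := by
  induction k with
  | zero => rfl
  | succ k ih => rw [propagator, propagator, ih fun i hi => h i (by omega), h k (by omega)]

theorem propagator_apply_eq_self {E : ℕ → MultiOp d →ₗ[ℂ] MultiOp d} {ρ : MultiOp d}
    (h : ∀ t, E t ρ = ρ) (s k : ℕ) : propagator E s k ρ = ρ := by
  induction k with
  | zero => rfl
  | succ k ih => rw [propagator, LinearMap.comp_apply, ih, h]

/-- If every window of fixed length halves the base norm, then all densities converge to the
common fixed point. -/
theorem tendsto_propagator {E : ℕ → MultiOp d →ₗ[ℂ] MultiOp d} {ρ σ : MultiOp d} {W : ℕ}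
    (hW : 0 < W) (hE : ∀ t, IsPositiveTP (E t).toContinuousLinearMap) (hfix : ∀ t, E t ρ = ρ)
    (hc : ∀ s, ContractsBy (propagator E s W).toContinuousLinearMap (1 / 2))
    (hρ : IsDensity ρ) (hσ : IsDensity σ) (s : ℕ) :
    Tendsto (fun k => propagator E s k σ) atTop (𝓝 ρ) := by
  obtain ⟨C, -, hC⟩ := exists_norm_le_of_mem_densityDiff (ι := ∀ a, Fin (d a))
  have hwin : ∀ q s, ContractsBy (propagator E s (W * q)).toContinuousLinearMap ((1 / 2) ^ q) := by
    intro q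
    induction q with
    | zero => intro s; rw [pow_zero]; exact IsPositiveTP.one.contractsBy_one
    | succ q ih =>
      intro s
      rw [Nat.mul_succ, propagator_add, pow_succ']
      exact (hc (s + W * q)).mul (ih s)
  rw [tendsto_iff_norm_sub_tendsto_zero]
  -- After `k` steps `k / W` full windows have passed; the remaining steps do not expand the norm.
  have hlim : Tendsto (fun k : ℕ => (1 / 2 : ℝ) ^ (k / W) * C) atTop (𝓝 0) := by
    simpa using ((tendsto_pow_atTop_nhds_zero_of_lt_one (r := (1 / 2 : ℝ)) (by norm_num)
      (by norm_num)).comp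
      (Nat.tendsto_div_const_atTop hW.ne')).mul_const C
  refine squeeze_zero (fun k => norm_nonneg _) (fun k => ?_) hlim
  have h1 : propagator E s k σ - ρ = propagator E s k (σ - ρ) := by
    rw [map_sub, propagator_apply_eq_self hfix]
  have h2 : ContractsBy (propagator E s k).toContinuousLinearMap ((1 / 2) ^ (k / W)) := by
    conv => enter [1]; rw [← Nat.div_add_mod k W, propagator_add]
    have := (propagator_isPositiveTP hE (s + W * (k / W)) (k % W)).contractsBy_one.mul
      (hwin (k / W) s)
    rwa [one_mul] at this
  rw [h1]
  exact h2.norm_apply_le hC (by positivity) ⟨σ, hσ, ρ, hρ, rfl⟩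

end MultiOp

/-- The limit of a trajectory of a uniformly continuous semigroup is an equilibrium. -/
theorem apply_eq_zero_of_tendsto_exp {V : Type*} [NormedAddCommGroup V] [NormedSpace ℂ V]
    [CompleteSpace V] {A : V →L[ℂ] V} {X Y : V}
    (h : Tendsto (fun t : ℝ => NormedSpace.exp ((t : ℂ) • A) X) atTop (𝓝 Y)) : A Y = 0 := by
  have hfix : ∀ s : ℝ, NormedSpace.exp ((s : ℂ) • A) Y = Y := by
    intro s
    have h1 : Tendsto (fun t : ℝ => NormedSpace.exp ((s : ℂ) • A)
        (NormedSpace.exp ((t : ℂ) • A) X)) atTop (𝓝 (NormedSpace.exp ((s : ℂ) • A) Y)) :=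
      ((NormedSpace.exp ((s : ℂ) • A)).continuous.tendsto Y).comp h
    have h2 := h.comp (tendsto_atTop_add_const_left atTop s tendsto_id)
    refine tendsto_nhds_unique h1 (h2.congr fun t => ?_)
    have hcomm : Commute ((s : ℂ) • A) ((t : ℂ) • A) :=
      ((Commute.refl A).smul_left _).smul_right _
    have h3 := exp_add_of_commute_complex hcomm
    simp only [Function.comp_apply, id]
    rw [← mul_apply_eq_comp, ← h3, ← add_smul, Complex.ofReal_add]
  have hd : HasDerivAt (fun s : ℝ => NormedSpace.exp ((s : ℂ) • A)) A 0 := by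
    simpa using hasDerivAt_exp_smul_const (𝕂 := ℝ) A 0
  have hd2 := ((ContinuousLinearMap.apply ℂ V Y).restrictScalars ℝ).hasFDerivAt.comp_hasDerivAt
    (0 : ℝ) hd
  have hd3 : HasDerivAt (fun _ : ℝ => Y) (A Y) 0 := by
    refine HasDerivAt.congr_of_eventuallyEq hd2 (Eventually.of_forall fun s => ?_)
    exact (hfix s).symm
  exact hd3.unique (hasDerivAt_const 0 Y)

/-! ### From a frustration-free generator to discrete-time stabilization. -/

section MultiOp

variable {n : ℕ} {d : Fin n → ℕ}

/-- Every factor is the identity at `s = 0`, so the product rule just adds the generators. -/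
theorem hasDerivAt_propagator {E : ℝ → ℕ → MultiOp d →ₗ[ℂ] MultiOp d}
    {l : ℕ → MultiOp d →L[ℂ] MultiOp d} (h0 : ∀ t, E 0 t = LinearMap.id)
    (h : ∀ t, HasDerivAt (fun s => (E s t).toContinuousLinearMap) (l t) 0) (k : ℕ) :
    propagator (E 0) 0 k = LinearMap.id ∧
    HasDerivAt (fun s => (propagator (E s) 0 k).toContinuousLinearMap)
      (∑ t ∈ Finset.range k, l t) 0 := by
  induction k with
  | zero =>
    refine ⟨rfl, ?_⟩
    rw [Finset.range_zero, Finset.sum_empty]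
    exact @hasDerivAt_one_zero (MultiOp d →L[ℂ] MultiOp d) _ _
  | succ k ih =>
    refine ⟨by rw [propagator, ih.1, h0, LinearMap.id_comp], ?_⟩
    have e1 : (propagator (E 0) 0 k).toContinuousLinearMap = 1 := by rw [ih.1]; rfl
    have e2 : (E 0 k).toContinuousLinearMap = 1 := by rw [h0]; rfl
    rw [Finset.sum_range_succ]
    have hm := @hasDerivAt_mul_of_eq_one (MultiOp d →L[ℂ] MultiOp d) _ _
      (fun s => (E s k).toContinuousLinearMap)
      (fun s => (propagator (E s) 0 k).toContinuousLinearMap) _ _ e2 e1 (h k) ih.2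
    simp only [propagator, zero_add]
    exact hm

theorem propagator_periodic {E : ℕ → MultiOp d →ₗ[ℂ] MultiOp d} {K : ℕ}
    (hE : ∀ t q, E (K * q + t) = E t) (k : ℕ) :
    (propagator E 0 (K * k)).toContinuousLinearMap =
      (propagator E 0 K).toContinuousLinearMap ^ k := by
  induction k with
  | zero => rfl
  | succ k ih =>
    rw [Nat.mul_succ, propagator_add, pow_succ', ← ih,
      propagator_congr (s := 0 + K * k) (s' := 0) (E' := E) fun i _ => by
        rw [zero_add, zero_add, hE]]
    rfl

theorem contractsBy_propagator_window {E : ℕ → MultiOp d →ₗ[ℂ] MultiOp d} {K m : ℕ} {r : ℝ}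
    (hK : 0 < K) (hE : ∀ t, IsPositiveTP (E t).toContinuousLinearMap)
    (hper : ∀ t q, E (K * q + t) = E t)
    (hc : ContractsBy (propagator E 0 m).toContinuousLinearMap r) (s : ℕ) :
    ContractsBy (propagator E s (K + m)).toContinuousLinearMap r := by
  have hlt := Nat.mod_lt s hK
  have hdm := Nat.div_add_mod s K
  have h1 : K + m = (K - s % K) + (m + s % K) := by omega
  have h2 : s + (K - s % K) = K * (s / K + 1) := by rw [Nat.mul_succ]; omega
  have h3 : propagator E (s + (K - s % K)) m = propagator E 0 m := by
    rw [h2]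
    exact propagator_congr fun i _ => by rw [hper, zero_add]
  rw [h1, propagator_add, propagator_add, h3]
  have := ((propagator_isPositiveTP hE (s + (K - s % K) + m) (s % K)).contractsBy_one.mul
    hc).mul (propagator_isPositiveTP hE s (K - s % K)).contractsBy_one
  rwa [one_mul, mul_one] at this

theorem isDiscreteQLS_of_isFrustrationFreeQLS {K : ℕ} (hK : 0 < K) {N : Fin K → Finset (Fin n)}
    {ρ : MultiOp d} (hρ : IsDensity ρ) (h : IsFrustrationFreeQLS N ρ) : IsDiscreteQLS N ρ := by
  have := hρ.nonempty
  obtain ⟨L, hL, hff, hlim⟩ := h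
  simp only [semigroup_apply] at hlim
  -- The only use of frustration freeness: it makes each separate step fix `ρ`.
  have hLρ : ∀ j, L j ρ = 0 :=
    (hff ρ hρ).1 (apply_eq_zero_of_tendsto_exp (hlim ρ hρ))
  set G : MultiOp d →L[ℂ] MultiOp d := (∑ j, L j).toContinuousLinearMap with hG
  set R : ℝ → Fin K → MultiOp d →L[ℂ] MultiOp d := fun s j =>
    Ring.inverse (1 - (s : ℂ) • (L j).toContinuousLinearMap) with hR
  set j : ℕ → Fin K := fun t => ⟨t % K, Nat.mod_lt t hK⟩ with hj
  set E : ℝ → ℕ → MultiOp d →ₗ[ℂ] MultiOp d := fun s t => R s (j t) with hE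
  have hE0 : ∀ t, E 0 t = LinearMap.id := fun t => by
    have h1 : R 0 (j t) = 1 := inverse_one_sub_zero_smul (L (j t)).toContinuousLinearMap
    simp only [hE, h1]
    rfl
  have hEd : ∀ t, HasDerivAt (fun s => (E s t).toContinuousLinearMap)
      (L (j t)).toContinuousLinearMap 0 := fun t =>
    hasDerivAt_inverse_one_sub_smul (L (j t)).toContinuousLinearMap
  obtain ⟨hP0, hPd⟩ := hasDerivAt_propagator hE0 hEd K
  have hsum : ∑ t ∈ Finset.range K, (L (j t)).toContinuousLinearMap = G := by
    rw [Finset.sum_range, hG, map_sum]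
    refine Finset.sum_congr rfl fun i _ => ?_
    simp only [hj, Nat.mod_eq_of_lt i.2]
  rw [hsum] at hPd
  obtain ⟨ε, hε, hhalf⟩ := exists_pos_contractsBy_half (ι := ∀ a, Fin (d a))
  obtain ⟨C, hC0, hC⟩ := exists_norm_le_of_mem_densityDiff (ι := ∀ a, Fin (d a))
  obtain ⟨t, hts, ht⟩ := ((tendsto_norm_densityDiff (l := atTop) (ρ := ρ)
    (f := fun t : ℝ => NormedSpace.exp ((t : ℂ) • G)) (fun σ hσ => hlim σ hσ)
    (half_pos hε)).and (eventually_gt_atTop 0)).exists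
  have hP1 : (propagator (E 0) 0 K).toContinuousLinearMap = 1 := by rw [hP0]; rfl
  have hchern := @tendsto_pow_exp_of_hasDerivAt (MultiOp d →L[ℂ] MultiOp d) _ _ _ inferInstance
    _ G hP1 hPd t ht
  have hseq : Tendsto (fun k : ℕ => t / (k : ℝ)) atTop (𝓝[>] 0) := by
    refine tendsto_nhdsWithin_iff.2 ⟨tendsto_const_div_atTop_nhds_zero_nat t, ?_⟩
    filter_upwards [eventually_gt_atTop 0] with k hk
    exact div_pos ht (by exact_mod_cast hk)
  have hchan : ∀ᶠ s : ℝ in 𝓝[>] 0, ∀ i, IsNeighborhoodChannel (N i)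
      (R s i : MultiOp d →ₗ[ℂ] MultiOp d) :=
    eventually_all.2 fun i => (hL i).eventually_isNeighborhoodChannel_inverse
  have hunit : ∀ᶠ s : ℝ in 𝓝[>] 0, ∀ i,
      IsUnit (1 - (s : ℂ) • (L i).toContinuousLinearMap) :=
    eventually_all.2 fun i => nhdsWithin_le_nhds
      (eventually_isUnit_one_sub_smul (L i).toContinuousLinearMap)
  -- On `densityDiff`, of norm at most `C`, this Chernoff error costs at most `ε / 2`; the other
  -- half is the size of `exp (t G)` there.
  have hδ : 0 < ε / (2 * (C + 1)) := by positivity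
  have hclose : ∀ᶠ k : ℕ in atTop, ‖(propagator (E (t / k)) 0 K).toContinuousLinearMap ^ k -
      NormedSpace.exp ((t : ℂ) • G)‖ < ε / (2 * (C + 1)) :=
    (tendsto_iff_norm_sub_tendsto_zero.1 hchern).eventually_lt_const hδ
  obtain ⟨k, hk, hch, hu⟩ := (hclose.and ((hseq.eventually hchan).and
    (hseq.eventually hunit))).exists
  set s : ℝ := t / k with hs
  have htp : ∀ t, IsPositiveTP (E s t).toContinuousLinearMap := fun t =>
    (hch (j t)).isPositiveTP
  have hper : ∀ t q, E s (K * q + t) = E s t := fun t q => by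
    simp only [hE, hj, Nat.mul_add_mod]
  have hfix : ∀ t, E s t ρ = ρ := fun t => by
    have h1 : (1 - (s : ℂ) • (L (j t)).toContinuousLinearMap) ρ = ρ := by
      have : (1 - (s : ℂ) • (L (j t)).toContinuousLinearMap) ρ = ρ - (s : ℂ) • L (j t) ρ := rfl
      rw [this, hLρ, smul_zero, sub_zero]
    have h2 : R s (j t) ((1 - (s : ℂ) • (L (j t)).toContinuousLinearMap) ρ) = ρ := by
      rw [← mul_apply_eq_comp, Ring.inverse_mul_cancel _ (hu (j t))]; rfl
    rw [h1] at h2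
    exact h2
  have hpow := propagator_periodic hper k
  have hcon : ContractsBy (propagator (E s) 0 (K * k)).toContinuousLinearMap (1 / 2) := by
    refine hhalf _ (propagator_isPositiveTP htp 0 _) fun X hX => ?_
    rw [hpow]
    have h1 : ((propagator (E s) 0 K).toContinuousLinearMap ^ k) X =
        ((propagator (E s) 0 K).toContinuousLinearMap ^ k - NormedSpace.exp ((t : ℂ) • G)) X +
          NormedSpace.exp ((t : ℂ) • G) X := by
      rw [_root_.sub_apply, sub_add_cancel]
    rw [h1]
    refine (norm_add_le _ _).trans_lt ?_
    have h2 := ContinuousLinearMap.le_opNorm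
      ((propagator (E s) 0 K).toContinuousLinearMap ^ k - NormedSpace.exp ((t : ℂ) • G)) X
    have h3 := mul_le_mul hk.le (hC X hX) (norm_nonneg _) hδ.le
    have h4 : ε / (2 * (C + 1)) * C ≤ ε / 2 := by
      rw [div_mul_eq_mul_div, div_le_div_iff₀ (by positivity) two_pos]
      nlinarith
    linarith [hts X hX]
  refine ⟨E s, fun t => ⟨j t, hch (j t)⟩, propagator_apply_eq_self hfix, fun σ hσ s₀ => ?_⟩
  exact tendsto_propagator (W := K + K * k) (by omega) htp hfix
    (contractsBy_propagator_window hK htp hper hcon) hρ hσ s₀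

end MultiOp

/-- Discrete-time quasi-local stabilizability is the same as stabilizability by a frustration-free
generator. The argument does not depend on `ρ` being pure or of full rank, nor on the neighborhoods
being proper. -/
theorem mainTheorem8 {n : ℕ} (d : Fin n → ℕ) {K : ℕ} (hK : 0 < K)
    (N : Fin K → Finset (Fin n)) (hN : ∀ j, N j ⊂ Finset.univ)
    (ρ : MultiOp d) (hρ : IsDensity ρ) (hpf : IsPure ρ ∨ IsFullRank ρ) :
    IsDiscreteQLS N ρ ↔ IsFrustrationFreeQLS N ρ :=
  ⟨isFrustrationFreeQLS_of_isDiscreteQLS hρ, isDiscreteQLS_of_isFrustrationFreeQLS hK hρ⟩
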